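/- Let $V_1$ be the complex vector space of binary linear forms with the natural action of $SL_2=SL_2(\mathbb{C})$, and let $nV_1=V_1\oplus\cdots\oplus V_1$ ($n$ summands). Let $\mathcal{I}_n=\mathbb{C}[nV_1]^{SL_2}$ be the algebra of joint invariants of $n$ linear forms, graded by the usual degree, and let $\mathcal{C}_n=\mathbb{C}[nV_1\oplus\mathbb{C}^2]^{SL_2}$ be the algebra of joint covariants of $n$ linear forms, graded by the degree of covariants, i.e. the degree in the coefficients of the $n$ forms (the coordinates on $\mathbb{C}^2$ have weight $0$). For a finitely generated graded complex domain $R=R_0\oplus R_1\oplus\cdots$ with $R_0=\mathbb{C}$, let $\mathcal{P}(R,z)=\sum_{j\ge 0}\dim(R_j)\,z^j$ be its Poincaré series (a rational function of $z$), let $r$ be the transcendence degree over $\mathbb{C}$ of the field of fractions of $R$, and let $$\deg(R)=\lim_{z\to 1}(1-z)^r\,\mathcal{P}(R,z).$$ For $m\ge 1$ let $N_m(z)=\sum_{k=1}^{m}\frac1k\binom{m-1}{k-1}\binom{m}{k-1}z^{k-1}$ be the Narayana polynomial. Then the graded pieces of $\mathcal{I}_n$ and $\mathcal{C}_n$ are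 finite-dimensional, the limits below exist, and (i) $\displaystyle \deg(\mathcal{I}_n)=\frac{1}{(n-1)\,2^{2n-3}}\binom{2n-4}{n-2}$ for all $n\ge 2$, and $\displaystyle \deg(\mathcal{I}_n)=\frac{N_{n-2}(1)}{2^{2n-3}}=\frac{1}{(n-1)\,2^{2n-3}}\binom{2n-4}{n-2}$ for all $n\ge 3$; (ii) $\displaystyle \deg(\mathcal{C}_n)=\frac{1}{2^{2n-2}}\binom{2n-2}{n-1}$ for all $n\ge 1$. -/

import Mathlib

open Filter Topology

noncomputable section

/-- The natural action of `SL₂(ℂ)` on `n`-tuples of binary linear forms. The `i`-th form is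
`x ↦ a i 0 * x 0 + a i 1 * x 1`; acting by `g` means substituting `g⁻¹ x` for `x`. -/
def actForms {n : ℕ} (g : Matrix.SpecialLinearGroup (Fin 2) ℂ) (a : Fin n → Fin 2 → ℂ) :
    Fin n → Fin 2 → ℂ :=
  fun i => Matrix.vecMul (a i) ((g⁻¹ : Matrix.SpecialLinearGroup (Fin 2) ℂ) : Matrix (Fin 2) (Fin 2) ℂ)

/-- The natural action of `SL₂(ℂ)` on `ℂ²`. -/
def actVec (g : Matrix.SpecialLinearGroup (Fin 2) ℂ) (x : Fin 2 → ℂ) : Fin 2 → ℂ :=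
  Matrix.mulVec (g : Matrix (Fin 2) (Fin 2) ℂ) x

/-- The value of a polynomial function on `n V₁` at an `n`-tuple of linear forms. -/
def evalForms {n : ℕ} (a : Fin n → Fin 2 → ℂ) : MvPolynomial (Fin n × Fin 2) ℂ →ₐ[ℂ] ℂ :=
  MvPolynomial.aeval fun p => a p.1 p.2

/-- The value of a polynomial function on `n V₁ ⊕ ℂ²` at an `n`-tuple of linear forms and a
vector. -/
def evalFormsVec {n : ℕ} (a : Fin n → Fin 2 → ℂ) (x : Fin 2 → ℂ) :
    MvPolynomial ((Fin n × Fin 2) ⊕ Fin 2) ℂ →ₐ[ℂ] ℂ :=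
  MvPolynomial.aeval (Sum.elim (fun p => a p.1 p.2) x)

/-- The algebra `ℂ[n V₁]^{SL₂}` of joint invariants of `n` binary linear forms. -/
def jointInvariants (n : ℕ) : Subalgebra ℂ (MvPolynomial (Fin n × Fin 2) ℂ) where
  carrier := {F | ∀ (g : Matrix.SpecialLinearGroup (Fin 2) ℂ) (a : Fin n → Fin 2 → ℂ),
    evalForms (actForms g a) F = evalForms a F}
  mul_mem' := fun hF hG g a => by rw [map_mul, map_mul, hF g a, hG g a]
  add_mem' := fun hF hG g a => by rw [map_add, map_add, hF g a, hG g a]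
  algebraMap_mem' := fun c g a => by rw [AlgHom.commutes, AlgHom.commutes]

/-- The algebra `ℂ[n V₁ ⊕ ℂ²]^{SL₂}` of joint covariants of `n` binary linear forms. -/
def jointCovariants (n : ℕ) : Subalgebra ℂ (MvPolynomial ((Fin n × Fin 2) ⊕ Fin 2) ℂ) where
  carrier := {F | ∀ (g : Matrix.SpecialLinearGroup (Fin 2) ℂ) (a : Fin n → Fin 2 → ℂ)
    (x : Fin 2 → ℂ), evalFormsVec (actForms g a) (actVec g x) F = evalFormsVec a x F}
  mul_mem' := fun hF hG g a x => by rw [map_mul, map_mul, hF g a x, hG g a x]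
  add_mem' := fun hF hG g a x => by rw [map_add, map_add, hF g a x, hG g a x]
  algebraMap_mem' := fun c g a x => by rw [AlgHom.commutes, AlgHom.commutes]

/-- The joint invariants that are homogeneous of degree `j`. -/
def invariantsPiece (n j : ℕ) : Submodule ℂ (jointInvariants n) :=
  (MvPolynomial.homogeneousSubmodule (Fin n × Fin 2) ℂ j).comap (jointInvariants n).val.toLinearMap

/-- The joint covariants of degree `j`. As usual for covariants, the degree is the degree in the
coefficients of the `n` forms; the coordinates of the vector in `ℂ²` have weight `0` (the degree
in them is called the order of the covariant). -/
def covariantsPiece (n j : ℕ) : Submodule ℂ (jointCovariants n) :=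
  (MvPolynomial.weightedHomogeneousSubmodule ℂ
    (Sum.elim (fun _ : Fin n × Fin 2 => 1) (fun _ : Fin 2 => 0) : (Fin n × Fin 2) ⊕ Fin 2 → ℕ)
    j).comap (jointCovariants n).val.toLinearMap

/-- The Poincaré series `∑ⱼ dim Rⱼ zʲ` of a graded complex algebra with pieces `𝒜 j = Rⱼ`. -/
def poincareSeries {R : Type*} [CommRing R] [Algebra ℂ R] (𝒜 : ℕ → Submodule ℂ R) :
    PowerSeries ℂ :=
  PowerSeries.mk fun j => (Module.finrank ℂ (𝒜 j) : ℂ)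

/-- The number `d` is the degree `lim_{z → 1} (1 - z)^r P(R, z)` of the graded algebra `R`, `r`
being the transcendence degree over `ℂ` of the field of fractions of `R`. The graded pieces are
finite-dimensional, and the Poincaré series is (the expansion at `0` of) a rational function
`p / q`, which gives `P(R, z)` its meaning for `z` near `1`. -/
def HasDegree {R : Type*} [CommRing R] [IsDomain R] [Algebra ℂ R] (𝒜 : ℕ → Submodule ℂ R)
    (d : ℂ) : Prop :=
  (∀ j, Module.Finite ℂ (𝒜 j)) ∧
  ∃ r : ℕ, Algebra.trdeg ℂ (FractionRing R) = (r : Cardinal) ∧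
  ∃ p q : Polynomial ℂ, q ≠ 0 ∧ (q : PowerSeries ℂ) * poincareSeries 𝒜 = (p : PowerSeries ℂ) ∧
    Tendsto (fun z : ℂ => (1 - z) ^ r * (p.eval z / q.eval z)) (𝓝[≠] 1) (𝓝 d)

/-- The Narayana polynomial `N_m(z) = ∑_{k=1}^m (1/k) C(m-1,k-1) C(m,k-1) z^{k-1}`. -/
def narayana (m : ℕ) : Polynomial ℂ :=
  ∑ k ∈ Finset.Icc 1 m,
    Polynomial.C ((1 / (k : ℂ)) * ((m - 1).choose (k - 1) : ℂ) * (m.choose (k - 1) : ℂ)) *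
      Polynomial.X ^ (k - 1)

end

/-! A vector x of ℂ² is the same as the linear form y ↦ det(x, y), so covariants of n forms are
invariants of n + 1 forms in which the last form has weight 0. Both algebras are thus handled as
invariants of linear forms. Since SL₂ is generated by elementary matrices, an invariant is a
polynomial killed by the two polarizations (`mem_polarInvariants_iff`). Together with the torus
weight these act as sl₂ and preserve the multidegree. Raising maps weight 0 onto weight 2, and its
kernel in weight 0 is the space of invariants. So the dimension of the invariants with multidegree
in a finite set is the number of monomials of weight 0 minus the number of weight 2
(`finrank_invariantSpace`).

Counting monomials shows that the invariants of m + 2 forms have dimension C(k+m, m) C(k+1+m, m) /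
(m+1) in degree 2k and 0 in odd degrees, and that the covariants of m + 1 forms have dimension
C(⌊j/2⌋+m, m) C(⌈j/2⌉+m, m) in degree j. Put D = 2m. On each parity class the dimension is a
polynomial with constant D-th difference, so (1 - z²)^(D+1) P(z) is a polynomial whose value at 1 is
the sum of the two differences (`exists_polynomial_mul_mk_spread`). Leading coefficients give these
differences (`fwdDiff_iter_choose_mul_choose`), and dividing by 2^(D+1) gives the degree.

The exponent D + 1 is the transcendence degree: the growth of the dimensions bounds it above
(`trdeg_le_of_filtration`), and explicit algebraically independent brackets bound it below
(`algebraicIndependent_bracket`). The Narayana value at 1 comes from Vandermonde's identity. -/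

/-! ### sl₂-theory with bounded weights -/

section WeightSpaces

/-- Operators `e`, `f` acting on a family of weight spaces as the raising and lowering operators
of `sl₂` do. -/
structure IsSl2WeightFamily {V : Type*} [AddCommGroup V] [Module ℂ V] (e f : V →ₗ[ℂ] V)
    (W : ℤ → Submodule ℂ V) : Prop where
  raise_mem : ∀ k, ∀ v ∈ W k, e v ∈ W (k + 2)
  lower_mem : ∀ k, ∀ v ∈ W k, f v ∈ W (k - 2)
  commutator : ∀ k, ∀ v ∈ W k, e (f v) = f (e v) + (k : ℂ) • v
  bounded : ∃ B : ℕ, ∀ k : ℤ, (B : ℤ) < |k| → W k = ⊥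

namespace IsSl2WeightFamily

variable {V : Type*} [AddCommGroup V] [Module ℂ V] {e f : V →ₗ[ℂ] V} {W : ℤ → Submodule ℂ V}

theorem swap (h : IsSl2WeightFamily e f W) : IsSl2WeightFamily f e fun k => W (-k) where
  raise_mem k v hv := by
    have := h.lower_mem _ v hv
    rwa [show -(k + 2) = -k - 2 by ring]
  lower_mem k v hv := by
    have := h.raise_mem _ v hv
    rwa [show -(k - 2) = -k + 2 by ring]
  commutator k v hv := by
    rw [h.commutator _ v hv]
    push_cast
    rw [neg_smul]
    abel
  bounded := by
    obtain ⟨B, hB⟩ := h.bounded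
    exact ⟨B, fun k hk => hB (-k) (by rwa [abs_neg])⟩

theorem pow_raise_mem (h : IsSl2WeightFamily e f W) {k : ℤ} {v : V} (hv : v ∈ W k) (N : ℕ) :
    (e ^ N) v ∈ W (k + 2 * N) := by
  induction N with
  | zero => simpa using hv
  | succ N ih =>
    rw [pow_succ', Module.End.mul_apply]
    have := h.raise_mem _ _ ih
    rwa [show k + 2 * ((N + 1 : ℕ) : ℤ) = k + 2 * N + 2 by push_cast; ring]

theorem exists_pow_raise_eq_zero (h : IsSl2WeightFamily e f W) {k : ℤ} {v : V} (hv : v ∈ W k) :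
    ∃ N : ℕ, (e ^ N) v = 0 := by
  obtain ⟨B, hB⟩ := h.bounded
  refine ⟨B + k.natAbs + 1, ?_⟩
  have := h.pow_raise_mem hv (B + k.natAbs + 1)
  rw [hB, Submodule.mem_bot] at this
  · exact this
  · rw [lt_abs]
    left
    have := neg_abs_le k
    have := abs_nonneg k
    push_cast
    omega

/-- Moving f past each factor e contributes the current weight; the weights k, k + 2, …, k + 2N add
up to (N + 1)(k + N). The scalar is nonzero for k ≥ 1, which drives the next two results. -/
theorem pow_raise_lower (h : IsSl2WeightFamily e f W) {k : ℤ} {v : V} (hv : v ∈ W k) (N : ℕ) :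
    (e ^ (N + 1)) (f v) =
      f ((e ^ (N + 1)) v) + (((N : ℂ) + 1) * (k + N)) • (e ^ N) v := by
  induction N with
  | zero => simpa using h.commutator _ _ hv
  | succ N ih =>
    rw [pow_succ', Module.End.mul_apply, ih, map_add, map_smul,
      h.commutator _ _ (h.pow_raise_mem hv (N + 1)), ← Module.End.mul_apply e, ← pow_succ',
      ← Module.End.mul_apply e, ← pow_succ', add_assoc, ← add_smul]
    congr 2
    push_cast
    ring

/-- If e^(N+1) v = 0, then e^N (e (f v)) = c e^N v with c ≠ 0, so subtracting e (c⁻¹ f v) from v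
leaves a vector killed by e^N. Induction on N replaces complete reducibility, and no finite
dimension is needed. -/
theorem exists_raise_eq (h : IsSl2WeightFamily e f W) {k : ℤ} (hk : 1 ≤ k) {v : V}
    (hv : v ∈ W k) : ∃ u ∈ W (k - 2), e u = v := by
  obtain ⟨N, hN⟩ := h.exists_pow_raise_eq_zero hv
  induction N generalizing v with
  | zero => exact ⟨0, zero_mem _, by simpa using hN.symm⟩
  | succ N ih =>
    have hc : (((N : ℂ) + 1) * (k + N)) ≠ 0 := by
      have : ((N : ℤ) + 1) * (k + N) ≠ 0 := by positivity
      exact_mod_cast this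
    set c := (((N : ℂ) + 1) * (k + N)) with hcdef
    have hmem : c⁻¹ • f v ∈ W (k - 2) := Submodule.smul_mem _ _ (h.lower_mem _ _ hv)
    have hmem' : e (c⁻¹ • f v) ∈ W k := by
      have := h.raise_mem _ _ hmem
      rwa [sub_add_cancel] at this
    obtain ⟨u, hu, hu'⟩ := ih (v := v - e (c⁻¹ • f v)) (sub_mem hv hmem') (by
      rw [map_sub, ← Module.End.mul_apply (e ^ N), ← pow_succ, map_smul, h.pow_raise_lower hv, hN,
        map_zero, zero_add, ← hcdef, inv_smul_smul₀ hc, sub_self])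
    exact ⟨u + c⁻¹ • f v, add_mem hu hmem, by rw [map_add, hu', sub_add_cancel]⟩

theorem eq_zero_of_lower_eq_zero (h : IsSl2WeightFamily e f W) {k : ℤ} (hk : 1 ≤ k) {v : V}
    (hv : v ∈ W k) (hfv : f v = 0) : v = 0 := by
  obtain ⟨N, hN⟩ := h.exists_pow_raise_eq_zero hv
  induction N with
  | zero => simpa using hN
  | succ N ih =>
    have hc : (((N : ℂ) + 1) * (k + N)) ≠ 0 := by
      have : ((N : ℤ) + 1) * (k + N) ≠ 0 := by positivity
      exact_mod_cast this
    have := h.pow_raise_lower hv N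
    rw [hfv, hN, map_zero, map_zero, zero_add, eq_comm, smul_eq_zero] at this
    exact ih (this.resolve_left hc)

theorem eq_zero_of_raise_eq_zero (h : IsSl2WeightFamily e f W) {k : ℤ} (hk : k ≤ -1) {v : V}
    (hv : v ∈ W k) (hev : e v = 0) : v = 0 :=
  h.swap.eq_zero_of_lower_eq_zero (k := -k) (by omega) (by simpa using hv) hev

/-- In weight 0 the commutator vanishes, so e kills f v; but f v has weight -2, where e is
injective. -/
theorem lower_eq_zero (h : IsSl2WeightFamily e f W) {v : V} (hv : v ∈ W 0) (hev : e v = 0) :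
    f v = 0 := by
  refine h.eq_zero_of_raise_eq_zero (by norm_num) (h.lower_mem _ _ hv) ?_
  rw [h.commutator _ _ hv, hev]
  simp

/-- Rank–nullity for e : W 0 → W 2, which is surjective because the target weight is positive. -/
theorem finrank_inf_ker (h : IsSl2WeightFamily e f W) [Module.Finite ℂ (W 0)] :
    Module.finrank ℂ (W 0 ⊓ LinearMap.ker e : Submodule ℂ V) + Module.finrank ℂ (W 2) =
      Module.finrank ℂ (W 0) := by
  let g : W 0 →ₗ[ℂ] W 2 := e.restrict fun v hv => by simpa using h.raise_mem 0 v hv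
  have hg : Function.Surjective g := by
    rintro ⟨v, hv⟩
    obtain ⟨u, hu, hu'⟩ := h.exists_raise_eq (k := 2) (by norm_num) hv
    exact ⟨⟨u, by simpa using hu⟩, Subtype.ext hu'⟩
  have hker : (LinearMap.ker g).map (W 0).subtype = W 0 ⊓ LinearMap.ker e := by
    ext v
    simp only [Submodule.mem_map, LinearMap.mem_ker, Submodule.subtype_apply, Subtype.exists,
      Submodule.mem_inf]
    constructor
    · rintro ⟨a, ha, h1, rfl⟩
      exact ⟨ha, congrArg Subtype.val h1⟩
    · rintro ⟨h1, h2⟩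
      exact ⟨v, h1, Subtype.ext h2, rfl⟩
  rw [← hker, Submodule.finrank_map_subtype_eq, ← LinearMap.finrank_range_add_finrank_ker g,
    LinearMap.range_eq_top.2 hg, finrank_top, add_comm]

end IsSl2WeightFamily

end WeightSpaces

open MvPolynomial

/-! ### Polarizations as raising and lowering operators on polynomials -/

section Polarization

/-- The derivation that replaces the `b`-th coefficient of each linear form by the other one. -/
noncomputable def polar (ι : Type*) (b : Fin 2) :
    Derivation ℂ (MvPolynomial (ι × Fin 2) ℂ) (MvPolynomial (ι × Fin 2) ℂ) :=
  mkDerivation ℂ fun p => if p.2 = b then X (p.1, b + 1) else 0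

/-- The multidegree of an exponent: the degree in each of the linear forms. -/
def multidegree {ι : Type*} (m : ι × Fin 2 →₀ ℕ) : ι → ℕ := fun i => m (i, 0) + m (i, 1)

/-- The torus weight of an exponent. -/
def torusWeight {ι : Type*} [Fintype ι] (m : ι × Fin 2 →₀ ℕ) : ℤ :=
  ∑ i, ((m (i, 0) : ℤ) - m (i, 1))

variable {ι : Type*}

theorem polar_X (b : Fin 2) (p : ι × Fin 2) :
    polar ι b (X p) = if p.2 = b then X (p.1, b + 1) else 0 :=
  mkDerivation_X _ _ _

/-- The exponents that occur in the polarization of the monomial with exponent `m`. -/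
def polarExponents (b : Fin 2) (m : ι × Fin 2 →₀ ℕ) : Set (ι × Fin 2 →₀ ℕ) :=
  {m' | ∃ i, m (i, b) ≠ 0 ∧ m' + Finsupp.single (i, b) 1 = m + Finsupp.single (i, b + 1) 1}

theorem polar_monomial_mem (b : Fin 2) (m : ι × Fin 2 →₀ ℕ) (r : ℂ) :
    polar ι b (monomial m r) ∈ restrictSupport ℂ (polarExponents b m) := by
  rw [polar, mkDerivation_monomial]
  refine Submodule.smul_mem _ _ (Submodule.sum_mem _ fun p hp => ?_)
  obtain ⟨i, c⟩ := p
  dsimp only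
  by_cases hc : c = b
  · subst hc
    rw [if_pos rfl, smul_eq_mul, X, monomial_mul]
    rw [monomial_mem_restrictSupport]
    left
    have hm : m (i, c) ≠ 0 := by simpa using hp
    refine ⟨i, hm, ?_⟩
    have : Finsupp.single (i, c) 1 ≤ m := by
      rw [Finsupp.single_le_iff]; omega
    rw [add_right_comm, tsub_add_cancel_of_le this]
  · rw [if_neg hc, smul_zero]
    exact zero_mem _

theorem polar_mem_restrictSupport (b : Fin 2) {A B : Set (ι × Fin 2 →₀ ℕ)}
    (h : ∀ m ∈ A, polarExponents b m ⊆ B) {F : MvPolynomial (ι × Fin 2) ℂ}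
    (hF : F ∈ restrictSupport ℂ A) : polar ι b F ∈ restrictSupport ℂ B := by
  rw [F.as_sum, map_sum]
  refine Submodule.sum_mem _ fun m hm => ?_
  exact restrictSupport_mono _ (h m ((mem_restrictSupport_iff ℂ).1 hF hm)) (polar_monomial_mem b m _)

theorem multidegree_of_mem_polarExponents {b : Fin 2} {m m' : ι × Fin 2 →₀ ℕ}
    (h : m' ∈ polarExponents b m) : multidegree m' = multidegree m := by
  classical
  obtain ⟨i, -, h⟩ := h
  ext j
  have h0 := DFunLike.congr_fun h (j, 0)
  have h1 := DFunLike.congr_fun h (j, 1)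
  simp only [multidegree]
  fin_cases b <;> simp [Finsupp.single_apply] at h0 h1 <;> split_ifs at h0 h1 <;> omega

variable [Fintype ι]

theorem torusWeight_add (m m' : ι × Fin 2 →₀ ℕ) :
    torusWeight (m + m') = torusWeight m + torusWeight m' := by
  simp only [torusWeight, ← Finset.sum_add_distrib]
  refine Finset.sum_congr rfl fun i _ => ?_
  simp; ring

theorem torusWeight_single (i : ι) (b : Fin 2) :
    torusWeight (Finsupp.single (i, b) 1) = if b = 0 then 1 else -1 := by
  classical
  rw [torusWeight, Finset.sum_eq_single i]
  · fin_cases b <;> simp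
  · intro j _ hj
    simp [hj.symm]
  · simp

theorem torusWeight_of_mem_polarExponents {b : Fin 2} {m m' : ι × Fin 2 →₀ ℕ}
    (h : m' ∈ polarExponents b m) :
    torusWeight m' = torusWeight m + if b = 0 then -2 else 2 := by
  obtain ⟨i, -, h⟩ := h
  have := congrArg torusWeight h
  rw [torusWeight_add, torusWeight_add, torusWeight_single, torusWeight_single] at this
  fin_cases b <;> simp at this ⊢ <;> omega

theorem abs_torusWeight_le (m : ι × Fin 2 →₀ ℕ) :
    |torusWeight m| ≤ ((∑ i, multidegree m i : ℕ) : ℤ) := by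
  push_cast
  refine (Finset.abs_sum_le_sum_abs _ _).trans (Finset.sum_le_sum fun i _ => ?_)
  simp only [multidegree]
  rw [abs_le]
  push_cast
  omega

/-- The commutator of the two polarizations multiplies each monomial by its torus weight. -/
theorem coeff_polar_commutator (F : MvPolynomial (ι × Fin 2) ℂ) (m : ι × Fin 2 →₀ ℕ) :
    coeff m (polar ι 1 (polar ι 0 F) - polar ι 0 (polar ι 1 F)) =
      (torusWeight m : ℂ) * coeff m F := by
  classical
  let H : Derivation ℂ (MvPolynomial (ι × Fin 2) ℂ) (MvPolynomial (ι × Fin 2) ℂ) :=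
    mkDerivation ℂ fun p => if p.2 = 0 then X p else - X p
  -- A commutator of derivations is a derivation, so it suffices to compare on variables; H is
  -- diagonal on monomials.
  have hH : ⁅polar ι 1, polar ι 0⁆ = H := by
    refine derivation_ext fun p => ?_
    obtain ⟨i, c⟩ := p
    rw [Derivation.commutator_apply, mkDerivation_X]
    fin_cases c <;> simp [polar_X]
  have hm : ∀ m r, H (monomial m r) = (torusWeight m : ℂ) • monomial m r := by
    intro m r
    rw [mkDerivation_monomial, Finsupp.sum_fintype _ _ (by simp), Fintype.sum_prod_type]
    have key : ∀ p : ι × Fin 2, monomial (m - Finsupp.single p 1) ((m p : ℕ) : ℂ) * X p =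
        ((m p : ℕ) : ℂ) • monomial m (1 : ℂ) := by
      intro p
      rw [X, monomial_mul, mul_one, smul_monomial, smul_eq_mul, mul_one]
      by_cases h0 : m p = 0
      · simp [h0]
      · rw [tsub_add_cancel_of_le]
        rw [Finsupp.single_le_iff]; omega
    simp only [Fin.sum_univ_two, smul_eq_mul, if_pos, Fin.isValue, one_ne_zero, if_false, mul_neg,
      key, ← sub_eq_add_neg, ← sub_smul, ← Finset.sum_smul]
    rw [smul_comm, smul_monomial, smul_eq_mul, mul_one, torusWeight]
    push_cast
    rfl
  rw [← Derivation.commutator_apply, hH]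
  induction F using MvPolynomial.induction_on' with
  | monomial m' r =>
    rw [hm, coeff_smul, coeff_monomial, smul_eq_mul]
    split_ifs with h
    · rw [h]
    · rw [mul_zero, mul_zero]
  | add F G hF hG => rw [map_add, coeff_add, coeff_add, hF, hG, mul_add]

theorem polar_commutator {k : ℤ} {F : MvPolynomial (ι × Fin 2) ℂ}
    (hF : F ∈ restrictSupport ℂ {m | torusWeight m = k}) :
    polar ι 1 (polar ι 0 F) = polar ι 0 (polar ι 1 F) + (k : ℂ) • F := by
  rw [← sub_eq_iff_eq_add']
  ext m
  rw [coeff_polar_commutator, coeff_smul, smul_eq_mul]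
  by_cases h : coeff m F = 0
  · rw [h, mul_zero, mul_zero]
  · have : torusWeight m = k := (mem_restrictSupport_iff ℂ).1 hF (mem_support_iff.2 h)
    rw [this]

/-- Polynomials all of whose monomials have multidegree in `𝒢` and torus weight `k`. -/
noncomputable def weightSpace (𝒢 : Set (ι → ℕ)) (k : ℤ) : Submodule ℂ (MvPolynomial (ι × Fin 2) ℂ) :=
  restrictSupport ℂ {m | multidegree m ∈ 𝒢 ∧ torusWeight m = k}

/-- Polarization preserves the multidegree, so any set of multidegrees is allowed; a bound on the
total degree also bounds the torus weight. -/
theorem isSl2WeightFamily_weightSpace {𝒢 : Set (ι → ℕ)} {B : ℕ} (h : ∀ μ ∈ 𝒢, ∑ i, μ i ≤ B) :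
    IsSl2WeightFamily (polar ι 1).toLinearMap (polar ι 0).toLinearMap (weightSpace 𝒢) where
  raise_mem k v hv := by
    refine polar_mem_restrictSupport 1 (fun m hm m' hm' => ?_) hv
    refine ⟨?_, ?_⟩
    · rw [multidegree_of_mem_polarExponents hm']; exact hm.1
    · rw [torusWeight_of_mem_polarExponents hm', hm.2]; simp
  lower_mem k v hv := by
    refine polar_mem_restrictSupport 0 (fun m hm m' hm' => ?_) hv
    refine ⟨?_, ?_⟩
    · rw [multidegree_of_mem_polarExponents hm']; exact hm.1
    · rw [torusWeight_of_mem_polarExponents hm', hm.2]; simp; ring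
  commutator k v hv := polar_commutator (restrictSupport_mono _ (fun m hm => hm.2) hv)
  bounded := by
    refine ⟨B, fun k hk => ?_⟩
    have : {m : ι × Fin 2 →₀ ℕ | multidegree m ∈ 𝒢 ∧ torusWeight m = k} = ∅ := by
      ext m
      simp only [Set.mem_ofPred_eq, Set.mem_empty_iff_false, iff_false]
      rintro ⟨h1, rfl⟩
      have h2 := abs_torusWeight_le m
      have h3 := h _ h1
      omega
    rw [weightSpace, this, restrictSupport_eq_span]
    simp

end Polarization

/-! ### SL₂-invariance as annihilation by polarizations; covariants as invariants -/

section GroupAction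

variable {ι : Type*}

/-- The polynomials annihilated by both polarizations. -/
noncomputable def polarInvariants (ι : Type*) : Subalgebra ℂ (MvPolynomial (ι × Fin 2) ℂ) where
  carrier := {F | ∀ b, polar ι b F = 0}
  mul_mem' := fun hF hG b => by rw [Derivation.leibniz, hF b, hG b]; simp
  add_mem' := fun hF hG b => by rw [map_add, hF b, hG b, add_zero]
  algebraMap_mem' := fun c b => Derivation.map_algebraMap _ c

theorem mem_polarInvariants {F : MvPolynomial (ι × Fin 2) ℂ} :
    F ∈ polarInvariants ι ↔ ∀ b, polar ι b F = 0 := Iff.rfl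

/-- The value of a polynomial at a tuple of linear forms. -/
noncomputable def evalTuple (a : ι → Fin 2 → ℂ) : MvPolynomial (ι × Fin 2) ℂ →ₐ[ℂ] ℂ :=
  aeval fun p => a p.1 p.2

/-- The restriction of a polynomial to the line through `a` along which the `b`-th coefficients
move in the direction of the other ones. -/
noncomputable def shearLine (b : Fin 2) (a : ι → Fin 2 → ℂ) :
    MvPolynomial (ι × Fin 2) ℂ →ₐ[ℂ] Polynomial ℂ :=
  aeval fun p => Polynomial.C (a p.1 p.2) +
    if p.2 = b then Polynomial.X * Polynomial.C (a p.1 (b + 1)) else 0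

/-- The chain rule along the line: the velocity is given by the coefficients with index b + 1, which
do not move. -/
theorem derivative_shearLine (b : Fin 2) (a : ι → Fin 2 → ℂ) (F : MvPolynomial (ι × Fin 2) ℂ) :
    Polynomial.derivative (shearLine b a F) = shearLine b a (polar ι b F) := by
  induction F using MvPolynomial.induction_on with
  | C r => simp [shearLine]
  | add F G hF hG => simp [hF, hG]
  | mul_X F p hF =>
    have hX : Polynomial.derivative (shearLine b a (X p)) = shearLine b a (polar ι b (X p)) := by
      rw [polar_X]
      have hb : b + 1 ≠ b := by fin_cases b <;> decide
      split_ifs with h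
      · simp [shearLine, h, hb]
      · simp [shearLine, h]
    rw [map_mul, Polynomial.derivative_mul, hF, hX, Derivation.leibniz, map_add, smul_eq_mul,
      smul_eq_mul, map_mul, map_mul]
    ring

/-- Adding `t` times the other coefficients to the `b`-th coefficients. -/
def shear (b : Fin 2) (t : ℂ) (a : ι → Fin 2 → ℂ) : ι → Fin 2 → ℂ :=
  fun i c => a i c + if c = b then t * a i (b + 1) else 0

theorem eval_shearLine (b : Fin 2) (a : ι → Fin 2 → ℂ) (t : ℂ) (F : MvPolynomial (ι × Fin 2) ℂ) :
    (shearLine b a F).eval t = evalTuple (shear b t a) F := by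
  have : ((Polynomial.aeval t).comp (shearLine b a) : MvPolynomial (ι × Fin 2) ℂ →ₐ[ℂ] ℂ) =
      evalTuple (shear b t a) := by
    refine algHom_ext fun p => ?_
    simp only [shearLine, evalTuple, shear, AlgHom.comp_apply, aeval_X]
    split_ifs <;> simp [mul_comm t]
  rw [← this]
  simp

theorem shear_zero (b : Fin 2) (a : ι → Fin 2 → ℂ) : shear b 0 a = a := by
  ext i c; simp [shear]

theorem evalTuple_injective {F G : MvPolynomial (ι × Fin 2) ℂ}
    (h : ∀ a : ι → Fin 2 → ℂ, evalTuple a F = evalTuple a G) : F = G := by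
  refine MvPolynomial.funext fun x => ?_
  have := h fun i b => x (i, b)
  simp only [evalTuple, Prod.mk.eta] at this
  rwa [← coe_aeval_eq_eval]

theorem polar_eq_zero_iff (b : Fin 2) (F : MvPolynomial (ι × Fin 2) ℂ) :
    polar ι b F = 0 ↔ ∀ t a, evalTuple (shear b t a) F = evalTuple a F := by
  constructor
  · intro h t a
    have h1 := derivative_shearLine b a F
    rw [h, map_zero] at h1
    have h2 := eval_shearLine b a t F
    have h3 := eval_shearLine b a 0 F
    rw [Polynomial.eq_C_of_derivative_eq_zero h1, Polynomial.eval_C] at h2 h3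
    rw [shear_zero] at h3
    rw [← h2, h3]
  · intro h
    refine evalTuple_injective fun a => ?_
    rw [map_zero, ← shear_zero b a, ← eval_shearLine, ← derivative_shearLine]
    have : shearLine b a F = Polynomial.C (evalTuple a F) :=
      Polynomial.funext fun t => by rw [eval_shearLine, h, Polynomial.eval_C]
    rw [this, Polynomial.derivative_C, Polynomial.eval_zero]

theorem vecMul_transvection_tuple {b : Fin 2} (hb : b + 1 ≠ b) (t : ℂ) (a : ι → Fin 2 → ℂ) :
    (fun i => Matrix.vecMul (a i)
      (Matrix.SpecialLinearGroup.transvection hb t : Matrix.SpecialLinearGroup (Fin 2) ℂ).1) =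
      shear b t a := by
  ext i c
  have : (Matrix.SpecialLinearGroup.transvection hb t : Matrix.SpecialLinearGroup (Fin 2) ℂ).1 =
    Matrix.transvection (b + 1) b t := rfl
  rw [this, Matrix.transvection, Matrix.vecMul_add, Matrix.vecMul_one]
  fin_cases b <;> fin_cases c <;>
    simp [shear, Matrix.vecMul, dotProduct, Matrix.single_apply, mul_comm]

/-- `SL₂` is generated by the elementary matrices. -/
theorem specialLinearGroup_two_mem_of_transvection
    (H : Submonoid (Matrix.SpecialLinearGroup (Fin 2) ℂ))
    (h : ∀ (b : Fin 2) (hb : b + 1 ≠ b) (t : ℂ),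
      Matrix.SpecialLinearGroup.transvection hb t ∈ H)
    (g : Matrix.SpecialLinearGroup (Fin 2) ℂ) : g ∈ H := by
  have h01 : (0 : Fin 2) + 1 ≠ 0 := by decide
  have h10 : (1 : Fin 2) + 1 ≠ 1 := by decide
  -- With a nonzero lower left entry, g is an explicit product upper · lower · upper of elementary
  -- matrices.
  have key : ∀ g : Matrix.SpecialLinearGroup (Fin 2) ℂ, g.1 1 0 ≠ 0 → g ∈ H := by
    intro g hg
    have hdet := g.det_coe
    rw [Matrix.det_fin_two] at hdet
    have : g = Matrix.SpecialLinearGroup.transvection h10 ((g.1 0 0 - 1) / g.1 1 0) *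
        Matrix.SpecialLinearGroup.transvection h01 (g.1 1 0) *
        Matrix.SpecialLinearGroup.transvection h10 ((g.1 1 1 - 1) / g.1 1 0) := by
      ext i j
      simp only [Matrix.SpecialLinearGroup.coe_mul, Matrix.SpecialLinearGroup.transvection_coe]
      fin_cases i <;> fin_cases j <;>
        simp [Matrix.mul_apply, Fin.sum_univ_two, Matrix.single_apply] <;> field_simp <;>
        first | ring1 | linear_combination -hdet
    rw [this]
    exact H.mul_mem (H.mul_mem (h _ _ _) (h _ _ _)) (h _ _ _)
  by_cases hg : g.1 1 0 = 0
  · have hdet := g.det_coe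
    rw [Matrix.det_fin_two, hg, mul_zero, sub_zero] at hdet
    -- If the lower left entry vanishes, adding the first row to the second makes it equal to the
    -- upper left entry, which is nonzero by the determinant.
    have hg' : g = Matrix.SpecialLinearGroup.transvection h01 (-1) *
        (Matrix.SpecialLinearGroup.transvection h01 1 * g) := by
      rw [← mul_assoc]
      convert (one_mul g).symm
      ext i j
      simp only [Matrix.SpecialLinearGroup.coe_mul, Matrix.SpecialLinearGroup.transvection_coe]
      fin_cases i <;> fin_cases j <;>
        simp [Matrix.mul_apply, Fin.sum_univ_two, Matrix.single_apply]
    rw [hg']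
    refine H.mul_mem (h _ _ _) (key _ ?_)
    have : g.1 0 0 ≠ 0 := left_ne_zero_of_mul (hdet.symm ▸ one_ne_zero)
    have h1 : (Matrix.SpecialLinearGroup.transvection h01 (1 : ℂ) * g).1 1 0 = g.1 0 0 := by
      rw [Matrix.SpecialLinearGroup.coe_mul, Matrix.SpecialLinearGroup.transvection_coe]
      simp [Matrix.mul_apply, Fin.sum_univ_two, Matrix.single_apply, hg]
    rwa [h1]
  · exact key g hg

theorem mem_polarInvariants_iff (F : MvPolynomial (ι × Fin 2) ℂ) :
    F ∈ polarInvariants ι ↔ ∀ (g : Matrix.SpecialLinearGroup (Fin 2) ℂ) (a : ι → Fin 2 → ℂ),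
      evalTuple (fun i => Matrix.vecMul (a i) (g⁻¹).1) F = evalTuple a F := by
  have hb : ∀ b : Fin 2, b + 1 ≠ b := by decide
  rw [mem_polarInvariants]
  simp only [polar_eq_zero_iff]
  constructor
  · intro h g
    let H : Submonoid (Matrix.SpecialLinearGroup (Fin 2) ℂ) :=
      { carrier := {g | ∀ a, evalTuple (fun i => Matrix.vecMul (a i) g.1) F = evalTuple a F}
        one_mem' := fun a => by simp
        mul_mem' := fun {x y} hx hy a => by
          have := hy fun i => Matrix.vecMul (a i) x.1
          simp only [Matrix.vecMul_vecMul] at this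
          rw [Matrix.SpecialLinearGroup.coe_mul, this]
          exact hx a }
    exact specialLinearGroup_two_mem_of_transvection H
      (fun b hb t a => by rw [vecMul_transvection_tuple]; exact h b t a) g⁻¹
  · intro h b t a
    have := h (Matrix.SpecialLinearGroup.transvection (hb b) t)⁻¹ a
    rwa [inv_inv, vecMul_transvection_tuple] at this

theorem jointInvariants_eq (n : ℕ) : jointInvariants n = polarInvariants (Fin n) := by
  ext F
  rw [mem_polarInvariants_iff]
  rfl

/-- The image of the variables under the identification of covariants of forms with invariants of
one more form. -/
noncomputable def covariantVariable (n : ℕ) :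
    (Fin n × Fin 2) ⊕ Fin 2 → MvPolynomial (Option (Fin n) × Fin 2) ℂ :=
  Sum.elim (fun p => X (some p.1, p.2)) ![X (none, 1), -X (none, 0)]

/-- The inverse substitution to `covariantVariable`. -/
noncomputable def covariantVariableInv (n : ℕ) :
    Option (Fin n) × Fin 2 → MvPolynomial ((Fin n × Fin 2) ⊕ Fin 2) ℂ :=
  fun p => p.1.elim (![-X (Sum.inr 1), X (Sum.inr 0)] p.2) fun i => X (Sum.inl (i, p.2))

/-- The identification of polynomials in `n` forms and a vector with polynomials in `n + 1`
forms, a vector being the same thing as a linear form. -/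
noncomputable def covariantEquiv (n : ℕ) : MvPolynomial ((Fin n × Fin 2) ⊕ Fin 2) ℂ ≃ₐ[ℂ]
    MvPolynomial (Option (Fin n) × Fin 2) ℂ :=
  AlgEquiv.ofAlgHom (aeval (covariantVariable n)) (aeval (covariantVariableInv n))
    (by
      refine algHom_ext fun p => ?_
      obtain ⟨_ | i, b⟩ := p <;> fin_cases b <;> simp [covariantVariable, covariantVariableInv])
    (by
      refine algHom_ext fun p => ?_
      obtain ⟨i, b⟩ | b := p <;> fin_cases b <;> simp [covariantVariable, covariantVariableInv])

/-- The linear form belonging to a vector, together with the given forms. -/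
def adjoinVec {n : ℕ} (a : Fin n → Fin 2 → ℂ) (x : Fin 2 → ℂ) : Option (Fin n) → Fin 2 → ℂ :=
  fun o => o.elim ![-x 1, x 0] a

theorem evalTuple_covariantEquiv {n : ℕ} (a : Fin n → Fin 2 → ℂ) (x : Fin 2 → ℂ)
    (F : MvPolynomial ((Fin n × Fin 2) ⊕ Fin 2) ℂ) :
    evalTuple (adjoinVec a x) (covariantEquiv n F) = evalFormsVec a x F := by
  have : ((evalTuple (adjoinVec a x)).comp (covariantEquiv n).toAlgHom) = evalFormsVec a x := by
    refine algHom_ext fun p => ?_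
    obtain ⟨i, b⟩ | b := p
    · simp [evalTuple, evalFormsVec, covariantEquiv, covariantVariable, adjoinVec]
    · fin_cases b <;> simp [evalTuple, evalFormsVec, covariantEquiv, covariantVariable, adjoinVec]
  exact DFunLike.congr_fun this F

/-- The adjoined form is y ↦ det(x, y), and det(g x, y) = det(x, g⁻¹ y) since det g = 1. -/
theorem adjoinVec_act {n : ℕ} (g : Matrix.SpecialLinearGroup (Fin 2) ℂ) (a : Fin n → Fin 2 → ℂ)
    (x : Fin 2 → ℂ) : adjoinVec (actForms g a) (actVec g x) =
      fun i => Matrix.vecMul (adjoinVec a x i) (g⁻¹).1 := by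
  ext o b
  cases o with
  | some i => rfl
  | none =>
    fin_cases b <;>
      simp [adjoinVec, actVec, Matrix.vecMul, Matrix.mulVec, dotProduct, Fin.sum_univ_two,
        Matrix.SpecialLinearGroup.coe_inv, Matrix.adjugate_fin_two] <;> ring

theorem mem_jointCovariants_iff {n : ℕ} (F : MvPolynomial ((Fin n × Fin 2) ⊕ Fin 2) ℂ) :
    F ∈ jointCovariants n ↔ covariantEquiv n F ∈ polarInvariants (Option (Fin n)) := by
  have h1 : F ∈ jointCovariants n ↔ ∀ (g : Matrix.SpecialLinearGroup (Fin 2) ℂ)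
    (a : Fin n → Fin 2 → ℂ) (x : Fin 2 → ℂ),
    evalFormsVec (actForms g a) (actVec g x) F = evalFormsVec a x F := Iff.rfl
  rw [h1, mem_polarInvariants_iff]
  simp only [← evalTuple_covariantEquiv, adjoinVec_act]
  constructor
  · intro h g a
    have := h g (fun i => a (some i)) ![a none 1, - a none 0]
    have ha : adjoinVec (fun i => a (some i)) ![a none 1, - a none 0] = a := by
      ext o b
      cases o with
      | some i => rfl
      | none => fin_cases b <;> simp [adjoinVec]
    rwa [ha] at this
  · intro h g a x
    exact h g _

/-- Joint covariants of `n` forms are joint invariants of `n + 1` forms. -/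
noncomputable def jointCovariantsEquiv (n : ℕ) :
    jointCovariants n ≃ₐ[ℂ] polarInvariants (Option (Fin n)) :=
  ((covariantEquiv n).subalgebraMap (jointCovariants n)).trans
    (Subalgebra.equivOfEq _ _ (by
      ext F
      rw [Subalgebra.mem_map]
      constructor
      · rintro ⟨G, hG, rfl⟩
        exact (mem_jointCovariants_iff G).1 hG
      · intro hF
        exact ⟨(covariantEquiv n).symm F, (mem_jointCovariants_iff _).2 (by simpa using hF),
          by simp⟩))

end GroupAction

/-! ### Poincaré series of quasi-polynomials of period 2 -/

section HilbertSeries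

/-- The sequence with value `f k` at `2 k + ε` and zero at the numbers of the other parity. -/
def spread (ε : ℕ) (f : ℕ → ℂ) (j : ℕ) : ℂ := if j % 2 = ε then f (j / 2) else 0

theorem one_sub_X_sq_mul_mk_spread {ε : ℕ} (hε : ε < 2) (f : ℕ → ℂ) :
    (1 - PowerSeries.X ^ 2) * PowerSeries.mk (spread ε f) =
      PowerSeries.C (f 0) * PowerSeries.X ^ ε +
        PowerSeries.X ^ 2 * PowerSeries.mk (spread ε (fwdDiff 1 f)) := by
  ext j
  rw [sub_mul, one_mul, map_sub, map_add, PowerSeries.coeff_C_mul, PowerSeries.coeff_X_pow,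
    PowerSeries.coeff_X_pow_mul', PowerSeries.coeff_X_pow_mul', PowerSeries.coeff_mk,
    PowerSeries.coeff_mk, PowerSeries.coeff_mk]
  rcases lt_or_ge j 2 with hj | hj
  · rw [if_neg (by omega : ¬ 2 ≤ j), if_neg (by omega : ¬ 2 ≤ j)]
    interval_cases j <;> interval_cases ε <;> simp [spread]
  · obtain ⟨i, rfl⟩ := Nat.exists_eq_add_of_le' hj
    rw [if_pos hj, if_pos hj, if_neg (by omega : ¬ i + 2 = ε)]
    simp only [spread, fwdDiff, Nat.add_sub_cancel, Nat.add_mod_right,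
      Nat.add_div_right i (show 0 < 2 by norm_num)]
    split_ifs <;> simp

/-- Each factor 1 - X² replaces the sequence by its forward difference, up to a boundary term. All
boundary terms but the last still carry a factor 1 - X² and vanish at 1; the last one contributes c.
-/
theorem exists_polynomial_mul_mk_spread {ε : ℕ} (hε : ε < 2) (D : ℕ) (f : ℕ → ℂ) (c : ℂ)
    (hf : (fwdDiff 1)^[D] f = fun _ => c) :
    ∃ p : Polynomial ℂ, (1 - PowerSeries.X ^ 2) ^ (D + 1) * PowerSeries.mk (spread ε f) = (p : PowerSeries ℂ) ∧
      p.eval 1 = c := by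
  induction D generalizing f with
  | zero =>
    refine ⟨Polynomial.C (f 0) * Polynomial.X ^ ε, ?_, ?_⟩
    · rw [zero_add, pow_one, one_sub_X_sq_mul_mk_spread hε]
      have : PowerSeries.mk (spread ε (fwdDiff 1 f)) = 0 := by
        ext j
        simp only [Function.iterate_zero, id] at hf
        simp [spread, hf]
      simp [this]
    · simp only [Function.iterate_zero, id] at hf
      simp [hf]
  | succ D ih =>
    obtain ⟨p, hp, hp1⟩ := ih (fwdDiff 1 f) (by rw [← Function.iterate_succ_apply, hf])
    refine ⟨(1 - Polynomial.X ^ 2) ^ (D + 1) * (Polynomial.C (f 0) * Polynomial.X ^ ε) +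
      Polynomial.X ^ 2 * p, ?_, ?_⟩
    · rw [pow_succ (_ - _), mul_assoc, one_sub_X_sq_mul_mk_spread hε, mul_add,
        mul_left_comm _ (PowerSeries.X ^ 2), hp]
      simp
    · simp [hp1]

theorem tendsto_one_sub_pow_mul (D : ℕ) (p : Polynomial ℂ) :
    Tendsto (fun z : ℂ => (1 - z) ^ D *
      (p.eval z / ((1 - Polynomial.X ^ 2 : Polynomial ℂ) ^ D).eval z)) (𝓝[≠] 1)
      (𝓝 (p.eval 1 / 2 ^ D)) := by
  have h : Tendsto (fun z : ℂ => p.eval z / (1 + z) ^ D) (𝓝[≠] 1) (𝓝 (p.eval 1 / 2 ^ D)) := by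
    have : ContinuousAt (fun z : ℂ => p.eval z / (1 + z) ^ D) 1 := by
      refine p.continuous.continuousAt.div (by fun_prop) ?_
      norm_num
    have h2 := this.tendsto.mono_left (nhdsWithin_le_nhds (s := {1}ᶜ))
    norm_num at h2
    exact h2
  refine h.congr' ?_
  filter_upwards [self_mem_nhdsWithin] with z hz
  have hz1 : (1 - z) ^ D ≠ 0 := pow_ne_zero _ (sub_ne_zero.2 (Ne.symm hz))
  have : ((1 - Polynomial.X ^ 2 : Polynomial ℂ) ^ D).eval z = (1 - z) ^ D * (1 + z) ^ D := by
    simp only [Polynomial.eval_pow, Polynomial.eval_sub, Polynomial.eval_one, Polynomial.eval_X]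
    rw [← mul_pow]
    ring
  rw [this, mul_div_assoc', mul_div_mul_left _ _ hz1]

/-- The degree of a graded algebra whose dimensions in even and in odd degrees are given by
functions with constant `D`-th difference, `D + 1` being the transcendence degree. -/
theorem hasDegree_of_finrank {R : Type*} [CommRing R] [IsDomain R] [Algebra ℂ R]
    {𝒜 : ℕ → Submodule ℂ R} (hfin : ∀ j, Module.Finite ℂ (𝒜 j)) (D : ℕ)
    (htr : Algebra.trdeg ℂ R = ((D + 1 : ℕ) : Cardinal)) (f₀ f₁ : ℕ → ℂ)
    (h₀ : ∀ k, (Module.finrank ℂ (𝒜 (2 * k)) : ℂ) = f₀ k)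
    (h₁ : ∀ k, (Module.finrank ℂ (𝒜 (2 * k + 1)) : ℂ) = f₁ k) (c₀ c₁ : ℂ)
    (hc₀ : (fwdDiff 1)^[D] f₀ = fun _ => c₀) (hc₁ : (fwdDiff 1)^[D] f₁ = fun _ => c₁) :
    HasDegree 𝒜 ((c₀ + c₁) / 2 ^ (D + 1)) := by
  obtain ⟨p₀, hp₀, hp₀'⟩ := exists_polynomial_mul_mk_spread (show 0 < 2 by norm_num) D f₀ c₀ hc₀
  obtain ⟨p₁, hp₁, hp₁'⟩ := exists_polynomial_mul_mk_spread (show 1 < 2 by norm_num) D f₁ c₁ hc₁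
  have hinj : Function.Injective (algebraMap ℂ R) := (algebraMap ℂ R).injective
  have : FaithfulSMul ℂ R := (faithfulSMul_iff_algebraMap_injective _ _).2 hinj
  have htr' : Algebra.trdeg ℂ (FractionRing R) = ((D + 1 : ℕ) : Cardinal) := by
    rw [← trdeg_add_eq ℂ R (A := FractionRing R), htr]
    have : Algebra.IsAlgebraic R (FractionRing R) :=
      IsFractionRing.comap_isAlgebraic_iff (K := FractionRing R).mpr inferInstance
    rw [trdeg_eq_zero, add_zero]
  refine ⟨hfin, D + 1, htr', p₀ + p₁, (1 - Polynomial.X ^ 2) ^ (D + 1), ?_, ?_, ?_⟩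
  · refine pow_ne_zero _ fun h => ?_
    have := congrArg (Polynomial.eval 0) h
    simp at this
  · have hsum : poincareSeries 𝒜 = PowerSeries.mk (spread 0 f₀) + PowerSeries.mk (spread 1 f₁) := by
      ext j
      rw [poincareSeries, map_add, PowerSeries.coeff_mk, PowerSeries.coeff_mk,
        PowerSeries.coeff_mk]
      rcases Nat.even_or_odd' j with ⟨k, rfl | rfl⟩
      · rw [h₀]
        simp [spread]
      · rw [h₁]
        have e1 : (2 * k + 1) % 2 = 1 := by omega
        have e2 : (2 * k + 1) / 2 = k := by omega
        simp [spread, e1, e2]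
    rw [hsum, mul_add]
    simp [hp₀, hp₁]
  · rw [← hp₀', ← hp₁', ← Polynomial.eval_add]
    exact tendsto_one_sub_pow_mul _ _

theorem nonempty_linearEquiv_of_algEquiv {R R' : Type*} [CommRing R] [Algebra ℂ R] [CommRing R']
    [Algebra ℂ R'] (e : R ≃ₐ[ℂ] R') (S : Submodule ℂ R) (S' : Submodule ℂ R')
    (h : ∀ x, x ∈ S ↔ e x ∈ S') : Nonempty (S ≃ₗ[ℂ] S') := by
  have : S.map e.toLinearEquiv.toLinearMap = S' := by
    ext y
    rw [Submodule.mem_map]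
    constructor
    · rintro ⟨x, hx, rfl⟩
      exact (h x).1 hx
    · intro hy
      exact ⟨e.symm y, (h _).2 (by simpa using hy), by simp⟩
  subst this
  exact ⟨e.toLinearEquiv.submoduleMap S⟩

end HilbertSeries

/-! ### Upper and lower bounds for the transcendence degree -/

section TranscendenceDegree

theorem prod_pow_mem_filtration {R : Type*} [CommRing R] [Algebra ℂ R] {B : ℕ → Submodule ℂ R}
    (hmono : Monotone B) (hone : 1 ∈ B 0)
    (hmul : ∀ i j, ∀ x ∈ B i, ∀ y ∈ B j, x * y ∈ B (i + j))
    {m e N : ℕ} (x : Fin m → R) (hx : ∀ i, x i ∈ B e) (k : Fin m → ℕ) (hk : ∀ i, k i ≤ N) :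
    ∏ i, x i ^ k i ∈ B (m * (N * e)) := by
  have hpow : ∀ i n, x i ^ n ∈ B (n * e) := by
    intro i n
    induction n with
    | zero => simpa using hone
    | succ n ih =>
      rw [pow_succ, Nat.succ_mul]
      exact hmul _ _ _ ih _ (hx i)
  have hs : ∀ s : Finset (Fin m), ∏ i ∈ s, x i ^ k i ∈ B (s.card * (N * e)) := by
    intro s
    induction s using Finset.cons_induction with
    | empty => simpa using hone
    | cons i s hi ih =>
      rw [Finset.prod_cons, Finset.card_cons, Nat.succ_mul, add_comm]
      exact hmul _ _ _ (hmono (Nat.mul_le_mul_right e (hk i)) (hpow i (k i))) _ ih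
  simpa using hs Finset.univ

/-- An algebra with a filtration whose dimensions grow like a polynomial of degree `D` has
transcendence degree at most `D`. -/
theorem trdeg_le_of_filtration {R : Type*} [CommRing R] [IsDomain R] [Algebra ℂ R]
    {B : ℕ → Submodule ℂ R} (hmono : Monotone B) (hone : 1 ∈ B 0)
    (hmul : ∀ i j, ∀ x ∈ B i, ∀ y ∈ B j, x * y ∈ B (i + j)) (hex : ∀ x, ∃ J, x ∈ B J)
    (hfin : ∀ j, Module.Finite ℂ (B j)) (C D : ℕ)
    (hC : ∀ j, Module.finrank ℂ (B j) ≤ C * (j + 1) ^ D) :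
    Algebra.trdeg ℂ R ≤ (D : Cardinal) := by
  by_contra hlt
  rw [not_le] at hlt
  have hle : ((D + 1 : ℕ) : Cardinal) ≤ Algebra.trdeg ℂ R := by
    rwa [← Order.succ_le_iff, Cardinal.succ_natCast, ← Nat.cast_succ] at hlt
  have hinj : Function.Injective (algebraMap ℂ R) := (algebraMap ℂ R).injective
  have : FaithfulSMul ℂ R := (faithfulSMul_iff_algebraMap_injective _ _).2 hinj
  obtain ⟨s, hs⟩ := exists_isTranscendenceBasis ℂ R
  rw [← hs.cardinalMk_eq_trdeg, ← Cardinal.lift_mk_fin, ← Cardinal.lift_id'.{0} (Cardinal.mk s)] at hle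
  obtain ⟨⟨g, hg⟩⟩ := Cardinal.lift_mk_le'.1 hle
  set x : Fin (D + 1) → R := fun i => (g i : R) with hxdef
  have hx : AlgebraicIndependent ℂ x := hs.1.comp g hg
  choose J hJ using hex
  set e := ∑ i, J (x i) with he
  have hxe : ∀ i, x i ∈ B e := fun i =>
    hmono (Finset.single_le_sum (f := fun i => J (x i)) (fun _ _ => Nat.zero_le _)
      (Finset.mem_univ i)) (hJ (x i))
  -- The monomials in D + 1 independent elements with all exponents at most N are linearly
  -- independent and lie in a single filtration step.
  have hcard : ∀ N : ℕ, (N + 1) ^ (D + 1) ≤ C * ((D + 1) * (N * e) + 1) ^ D := by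
    intro N
    let v : (Fin (D + 1) → Fin (N + 1)) → B ((D + 1) * (N * e)) := fun k =>
      ⟨∏ i, x i ^ (k i : ℕ), prod_pow_mem_filtration hmono hone hmul x hxe _
        fun i => Nat.le_of_lt_succ (k i).2⟩
    have hv : LinearIndependent ℂ v := by
      refine LinearIndependent.of_comp (B ((D + 1) * (N * e))).subtype ?_
      have h1 : LinearIndependent ℂ fun m : Fin (D + 1) →₀ ℕ => aeval x (monomial m (1 : ℂ)) := by
        have := (basisMonomials (Fin (D + 1)) ℂ).linearIndependent.map_injOn
          (aeval x : MvPolynomial (Fin (D + 1)) ℂ →ₐ[ℂ] R).toLinearMap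
          (Function.Injective.injOn hx)
        simpa [Function.comp_def] using this
      let φ : (Fin (D + 1) → Fin (N + 1)) → (Fin (D + 1) →₀ ℕ) := fun k =>
        Finsupp.equivFunOnFinite.symm fun i => (k i : ℕ)
      have hφ : Function.Injective φ := by
        intro k k' h
        ext i
        exact DFunLike.congr_fun h i
      have h2 := h1.comp φ hφ
      convert h2 using 1
      ext k
      simp [v, φ, aeval_monomial, Finsupp.prod_fintype]
    have := hv.fintype_card_le_finrank
    simp only [Fintype.card_fun, Fintype.card_fin] at this
    exact this.trans (hC _)
  have h2 : ∀ N : ℕ, N + 1 ≤ C * ((D + 1) * e + 1) ^ D := by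
    intro N
    have h3 : (N + 1) ^ D * (N + 1) ≤ (N + 1) ^ D * (C * ((D + 1) * e + 1) ^ D) := by
      rw [← pow_succ]
      refine (hcard N).trans ?_
      rw [mul_left_comm ((N + 1) ^ D), ← mul_pow, mul_left_comm (D + 1)]
      gcongr
      nlinarith [Nat.zero_le N, Nat.zero_le ((D + 1) * e)]
    exact Nat.le_of_mul_le_mul_left h3 (by positivity)
  -- Here N is taken to be the right-hand side of `h2`, which does not depend on N.
  exact absurd (h2 _) (Nat.not_succ_le_self _)

variable {ι : Type*}

/-- The bracket of two linear forms. -/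
noncomputable def bracket (i j : ι) : polarInvariants ι :=
  ⟨X (i, 0) * X (j, 1) - X (i, 1) * X (j, 0), fun b => by
    rw [map_sub, Derivation.leibniz, Derivation.leibniz]
    simp only [polar_X]
    fin_cases b <;> simp <;> ring⟩

theorem evalTuple_bracket (a : ι → Fin 2 → ℂ) (i j : ι) :
    evalTuple a (bracket i j : MvPolynomial (ι × Fin 2) ℂ) = a i 0 * a j 1 - a i 1 * a j 0 := by
  simp [bracket, evalTuple]

/-- The brackets [u, i] and [v, i] can be given arbitrary values, as long as [u, v] ≠ 0, by taking
the forms u and v proportional to the two coordinates and solving for the others. For n forms this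
is (n - 1) + (n - 2) = 2n - 3 brackets. -/
theorem algebraicIndependent_bracket {u v : ι} (huv : v ≠ u) :
    AlgebraicIndependent ℂ (Sum.elim (fun i : {i // i ≠ u} => bracket u i.1)
      (fun i : {i // i ≠ u ∧ i ≠ v} => bracket v i.1)) := by
  classical
  rw [algebraicIndependent_iff]
  intro Q hQ
  -- The factor takes care of the points with [u, v] = 0, where the forms cannot be solved for.
  have hX : Q * X (Sum.inl ⟨v, huv⟩) = 0 := by
    refine MvPolynomial.funext fun c => ?_
    rw [map_mul, eval_X, map_zero]
    by_cases hc : c (Sum.inl ⟨v, huv⟩) = 0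
    · rw [hc, mul_zero]
    · let a : ι → Fin 2 → ℂ := fun i =>
        if h : i = u then ![1, 0] else
          if h' : i = v then ![0, c (Sum.inl ⟨v, huv⟩)] else
            ![-(c (Sum.inr ⟨i, h, h'⟩)) / c (Sum.inl ⟨v, huv⟩), c (Sum.inl ⟨i, h⟩)]
      have hu : a u = ![1, 0] := by simp [a]
      have hv : a v = ![0, c (Sum.inl ⟨v, huv⟩)] := by simp [a, huv]
      have hi : ∀ i (h : i ≠ u) (h' : i ≠ v), a i =
          ![-(c (Sum.inr ⟨i, h, h'⟩)) / c (Sum.inl ⟨v, huv⟩), c (Sum.inl ⟨i, h⟩)] := by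
        intro i h h'
        simp [a, h, h']
      have hcomp : ((evalTuple a).comp (polarInvariants ι).val).comp
          (aeval (Sum.elim (fun i : {i // i ≠ u} => bracket u i.1)
            (fun i : {i // i ≠ u ∧ i ≠ v} => bracket v i.1))) = aeval c := by
        refine algHom_ext fun p => ?_
        obtain ⟨i, h⟩ | ⟨i, h, h'⟩ := p
        · by_cases h' : i = v
          · subst h'
            simp [evalTuple_bracket, hu, hv]
          · simp [evalTuple_bracket, hu, hi i h h']
        · simp only [AlgHom.comp_apply, aeval_X, Sum.elim_inr, Subalgebra.coe_val,
            evalTuple_bracket, hv, hi i h h']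
          simp
          field_simp
      have := DFunLike.congr_fun hcomp Q
      rw [AlgHom.comp_apply, hQ, map_zero] at this
      rw [← coe_aeval_eq_eval, RingHom.coe_coe, ← this, zero_mul]
  exact (mul_eq_zero.1 hX).resolve_right (X_ne_zero _)

theorem le_trdeg_polarInvariants [Fintype ι] (h : 2 ≤ Fintype.card ι) :
    ((2 * Fintype.card ι - 3 : ℕ) : Cardinal) ≤ Algebra.trdeg ℂ (polarInvariants ι) := by
  classical
  obtain ⟨u, v, huv⟩ := Fintype.one_lt_card_iff.1 (show 1 < Fintype.card ι by omega)
  refine le_trans ?_ (algebraicIndependent_bracket huv.symm).cardinalMk_le_trdeg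
  rw [Cardinal.mk_fintype, Fintype.card_sum, Nat.cast_le]
  have h1 : Fintype.card {i // i ≠ u} = Fintype.card ι - 1 := by
    rw [Fintype.card_subtype_compl, Fintype.card_subtype_eq]
  have h2 : Fintype.card {i // i ≠ u ∧ i ≠ v} = Fintype.card ι - 2 := by
    rw [Fintype.card_subtype]
    have : (Finset.univ.filter fun i => i ≠ u ∧ i ≠ v) = (Finset.univ.erase v).erase u := by
      ext i; simp
    rw [this, Finset.card_erase_of_mem (by simp [huv]), Finset.card_erase_of_mem (by simp),
      Finset.card_univ]
    omega
  rw [h1, h2]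
  omega

end TranscendenceDegree

/-! ### Dimensions of graded pieces of the invariants -/

section GradedPieces

variable {ι : Type*} [Fintype ι]

theorem finrank_restrictSupport {σ : Type*} (s : Set (σ →₀ ℕ)) :
    Module.finrank ℂ (restrictSupport ℂ s) = s.ncard := by
  rw [Module.finrank_eq_nat_card_basis (basisRestrictSupport ℂ s), Set.ncard]
  rfl

theorem finite_restrictSupport {σ : Type*} {s : Set (σ →₀ ℕ)} (hs : s.Finite) :
    Module.Finite ℂ (restrictSupport ℂ s) := by
  have := hs.to_subtype
  exact Module.Finite.of_basis (basisRestrictSupport ℂ s)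

theorem finite_setOf_multidegree {𝒢 : Set (ι → ℕ)} (h : 𝒢.Finite) :
    {m : ι × Fin 2 →₀ ℕ | multidegree m ∈ 𝒢}.Finite := by
  classical
  obtain ⟨B, hB⟩ := h.bddAbove
  refine (Set.finite_Iic (Finsupp.equivFunOnFinite.symm fun p : ι × Fin 2 => B p.1)).subset ?_
  rintro m hm ⟨i, b⟩
  have := hB hm i
  simp only [multidegree] at this
  simp only [Finsupp.equivFunOnFinite_symm_apply_apply]
  fin_cases b <;> simp <;> omega

/-- The invariants all of whose monomials have multidegree in `𝒢`. -/
noncomputable def invariantSpace (𝒢 : Set (ι → ℕ)) : Submodule ℂ (MvPolynomial (ι × Fin 2) ℂ) :=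
  Subalgebra.toSubmodule (polarInvariants ι) ⊓ restrictSupport ℂ {m | multidegree m ∈ 𝒢}

theorem invariantSpace_eq (𝒢 : Set (ι → ℕ)) :
    invariantSpace 𝒢 = weightSpace 𝒢 0 ⊓ LinearMap.ker (polar ι 1).toLinearMap := by
  ext F
  rw [invariantSpace, Submodule.mem_inf, Submodule.mem_inf, Subalgebra.mem_toSubmodule,
    mem_polarInvariants, LinearMap.mem_ker]
  change _ ↔ _ ∧ polar ι 1 F = 0
  constructor
  · rintro ⟨hF, hF'⟩
    refine ⟨fun m hm => ⟨hF' hm, ?_⟩, hF 1⟩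
    have h := coeff_polar_commutator F m
    rw [hF 0, hF 1, map_zero, map_zero, sub_zero, coeff_zero, eq_comm, mul_eq_zero] at h
    exact_mod_cast h.resolve_right (mem_support_iff.1 hm)
  · rintro ⟨hF, hF'⟩
    refine ⟨fun b => ?_, restrictSupport_mono _ (fun m hm => hm.1) hF⟩
    -- The set 𝒢 may be infinite, so the total degree of F itself provides the bound on the weights.
    have hmem : F ∈ weightSpace {μ | ∑ i, μ i ≤ F.support.sup fun m => ∑ i, multidegree m i} 0 :=
      fun m hm => ⟨Finset.le_sup (f := fun m : ι × Fin 2 →₀ ℕ => ∑ i, multidegree m i) hm,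
        (hF hm).2⟩
    fin_cases b
    · exact (isSl2WeightFamily_weightSpace fun μ hμ => hμ).lower_eq_zero hmem hF'
    · exact hF'

theorem finrank_invariantSpace {𝒢 : Set (ι → ℕ)} (h : 𝒢.Finite) :
    Module.finrank ℂ (invariantSpace 𝒢) +
      {m : ι × Fin 2 →₀ ℕ | multidegree m ∈ 𝒢 ∧ torusWeight m = 2}.ncard =
      {m : ι × Fin 2 →₀ ℕ | multidegree m ∈ 𝒢 ∧ torusWeight m = 0}.ncard := by
  obtain ⟨B, hB⟩ := (h.image fun μ => ∑ i, μ i).bddAbove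
  have hfam := isSl2WeightFamily_weightSpace fun μ hμ => hB (Set.mem_image_of_mem _ hμ)
  have : Module.Finite ℂ (weightSpace 𝒢 0) :=
    finite_restrictSupport ((finite_setOf_multidegree h).subset fun m hm => hm.1)
  rw [invariantSpace_eq, ← finrank_restrictSupport, ← finrank_restrictSupport]
  exact hfam.finrank_inf_ker

theorem finite_invariantSpace {𝒢 : Set (ι → ℕ)} (h : 𝒢.Finite) :
    Module.Finite ℂ (invariantSpace 𝒢) := by
  have := finite_restrictSupport (finite_setOf_multidegree h)
  exact Submodule.finiteDimensional_of_le (inf_le_right :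
    invariantSpace 𝒢 ≤ restrictSupport ℂ {m | multidegree m ∈ 𝒢})

theorem weight_eq_sum_multidegree (w : ι → ℕ) (m : ι × Fin 2 →₀ ℕ) :
    Finsupp.weight (fun p : ι × Fin 2 => w p.1) m = ∑ i, multidegree m i * w i := by
  rw [Finsupp.weight_apply, Finsupp.sum_fintype _ _ (by simp), Fintype.sum_prod_type]
  simp [multidegree, add_mul]

theorem mem_weightedHomogeneousSubmodule_iff_support {σ : Type*} (w : σ → ℕ) (j : ℕ)
    (F : MvPolynomial σ ℂ) : F ∈ weightedHomogeneousSubmodule ℂ w j ↔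
      F ∈ restrictSupport ℂ {m | Finsupp.weight w m = j} := by
  rw [mem_weightedHomogeneousSubmodule, mem_restrictSupport_iff]
  constructor
  · intro h m hm
    exact h (mem_support_iff.1 hm)
  · intro h m hm
    exact h (mem_support_iff.2 hm)

/-- The invariants of weighted degree `j`, the form with index `i` having weight `w i`. -/
noncomputable def weightedPiece (w : ι → ℕ) (j : ℕ) : Submodule ℂ (polarInvariants ι) :=
  (weightedHomogeneousSubmodule ℂ (fun p : ι × Fin 2 => w p.1) j).comap
    (polarInvariants ι).val.toLinearMap

/-- The invariants of weighted degree at most `J`. -/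
noncomputable def weightedFiltration (w : ι → ℕ) (J : ℕ) : Submodule ℂ (polarInvariants ι) :=
  (restrictSupport ℂ {m | Finsupp.weight (fun p : ι × Fin 2 => w p.1) m ≤ J}).comap
    (polarInvariants ι).val.toLinearMap

/-- The weight depends only on the multidegree, which polarization preserves. Hence weighted
components of invariants are invariants. -/
theorem polar_weightedHomogeneousComponent (w : ι → ℕ) (j : ℕ) (b : Fin 2)
    (F : MvPolynomial (ι × Fin 2) ℂ) :
    polar ι b (weightedHomogeneousComponent (fun p => w p.1) j F) =
      weightedHomogeneousComponent (fun p => w p.1) j (polar ι b F) := by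
  induction F using MvPolynomial.induction_on' with
  | add F G hF hG => simp only [map_add, hF, hG]
  | monomial m r =>
    have h1 := isWeightedHomogeneous_monomial (fun p : ι × Fin 2 => w p.1) m r rfl
    have h2 : polar ι b (monomial m r) ∈ weightedHomogeneousSubmodule ℂ
        (fun p : ι × Fin 2 => w p.1) (Finsupp.weight (fun p : ι × Fin 2 => w p.1) m) := by
      rw [mem_weightedHomogeneousSubmodule_iff_support]
      refine restrictSupport_mono _ (fun m' hm' => ?_) (polar_monomial_mem b m r)
      show Finsupp.weight _ _ = _
      rw [weight_eq_sum_multidegree, weight_eq_sum_multidegree,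
        multidegree_of_mem_polarExponents hm']
    rw [weightedHomogeneousComponent_of_mem h1, weightedHomogeneousComponent_of_mem h2]
    split_ifs
    · rfl
    · exact map_zero _

theorem finite_weightedFiltration_and_finrank_le (w : ι → ℕ)
    (hfin : ∀ j, Module.Finite ℂ (weightedPiece w j)) (J : ℕ) :
    Module.Finite ℂ (weightedFiltration w J) ∧ Module.finrank ℂ (weightedFiltration w J) ≤
      ∑ j ∈ Finset.range (J + 1), Module.finrank ℂ (weightedPiece w j) := by
  induction J with
  | zero =>
    have : weightedFiltration w 0 = weightedPiece w 0 := by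
      ext F
      rw [weightedFiltration, weightedPiece, Submodule.mem_comap, Submodule.mem_comap,
        mem_weightedHomogeneousSubmodule_iff_support]
      simp only [Nat.le_zero]
    rw [this]
    exact ⟨hfin 0, by simp⟩
  | succ J ih =>
    obtain ⟨ih1, ih2⟩ := ih
    have hle : weightedFiltration w (J + 1) ≤
        weightedFiltration w J ⊔ weightedPiece w (J + 1) := by
      intro F hF
      have hc : weightedHomogeneousComponent (fun p : ι × Fin 2 => w p.1) (J + 1) F.1 ∈
          polarInvariants ι := fun b => by
        rw [polar_weightedHomogeneousComponent, F.2 b, map_zero]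
      let G : polarInvariants ι := ⟨_, hc⟩
      have hG : G ∈ weightedPiece w (J + 1) := weightedHomogeneousComponent_mem _ _ _
      have hFG : F - G ∈ weightedFiltration w J := by
        refine (mem_restrictSupport_iff ℂ).2 fun m hm => ?_
        have hm' : coeff m (F.1 - G.1) ≠ 0 := mem_support_iff.1 hm
        rw [coeff_sub] at hm'
        rw [show G.1 = weightedHomogeneousComponent (fun p : ι × Fin 2 => w p.1) (J + 1) F.1
          from rfl, coeff_weightedHomogeneousComponent] at hm'
        by_cases hw : Finsupp.weight (fun p : ι × Fin 2 => w p.1) m = J + 1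
        · rw [if_pos hw, sub_self] at hm'
          exact absurd rfl hm'
        · rw [if_neg hw, sub_zero] at hm'
          have : Finsupp.weight (fun p : ι × Fin 2 => w p.1) m ≤ J + 1 :=
            hF (mem_support_iff.2 hm')
          show Finsupp.weight (fun p : ι × Fin 2 => w p.1) m ≤ J
          omega
      rw [← sub_add_cancel F G]
      exact Submodule.add_mem_sup hFG hG
    have := hfin (J + 1)
    refine ⟨Submodule.finiteDimensional_of_le hle, (Submodule.finrank_mono hle).trans ?_⟩
    rw [Finset.sum_range_succ]
    exact (Submodule.finrank_add_le_finrank_add_finrank _ _).trans (Nat.add_le_add_right ih2 _)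

/-- Summing the first j + 1 graded dimensions raises the order of growth by one, whence the bound D
+ 1. -/
theorem trdeg_polarInvariants_le (w : ι → ℕ)
    (hfin : ∀ j, Module.Finite ℂ (weightedPiece w j)) (C D : ℕ)
    (hC : ∀ j, Module.finrank ℂ (weightedPiece w j) ≤ C * (j + 1) ^ D) :
    Algebra.trdeg ℂ (polarInvariants ι) ≤ ((D + 1 : ℕ) : Cardinal) := by
  refine trdeg_le_of_filtration (B := weightedFiltration w) ?_ ?_ ?_ ?_
    (fun j => (finite_weightedFiltration_and_finrank_le w hfin j).1) C (D + 1) fun j => ?_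
  · intro J J' h
    exact Submodule.comap_mono (restrictSupport_mono _ fun m hm => le_trans hm h)
  · show (1 : MvPolynomial (ι × Fin 2) ℂ) ∈ restrictSupport ℂ _
    rw [← C_1, C_apply, monomial_mem_restrictSupport]
    left
    simp
  · intro i j x hx y hy
    show (x.1 * y.1) ∈ restrictSupport ℂ _
    have := Submodule.mul_mem_mul (show x.1 ∈ restrictSupport ℂ _ from hx)
      (show y.1 ∈ restrictSupport ℂ _ from hy)
    rw [← restrictSupport_add] at this
    refine restrictSupport_mono _ ?_ this
    rintro _ ⟨m, hm, m', hm', rfl⟩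
    show Finsupp.weight _ (m + m') ≤ i + j
    rw [map_add]
    exact add_le_add hm hm'
  · intro F
    exact ⟨F.1.support.sup fun m => Finsupp.weight (fun p : ι × Fin 2 => w p.1) m,
      fun m hm => Finset.le_sup (f := fun m => Finsupp.weight (fun p : ι × Fin 2 => w p.1) m) hm⟩
  · refine (finite_weightedFiltration_and_finrank_le w hfin j).2.trans ?_
    refine (Finset.sum_le_card_nsmul _ _ (C * (j + 1) ^ D) fun i hi => ?_).trans ?_
    · refine (hC i).trans ?_
      have : i ≤ j := Nat.lt_succ_iff.1 (Finset.mem_range.1 hi)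
      gcongr
    · rw [Finset.card_range, smul_eq_mul, pow_succ]
      exact le_of_eq (by ring)

theorem weightedPiece_equiv (w : ι → ℕ) (j : ℕ) :
    Nonempty (weightedPiece w j ≃ₗ[ℂ] invariantSpace {μ : ι → ℕ | ∑ i, μ i * w i = j}) := by
  have : (weightedPiece w j).map (polarInvariants ι).val.toLinearMap =
      invariantSpace {μ : ι → ℕ | ∑ i, μ i * w i = j} := by
    ext F
    simp only [invariantSpace, Submodule.mem_inf, Submodule.mem_map, weightedPiece,
      Submodule.mem_comap, mem_weightedHomogeneousSubmodule_iff_support,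
      weight_eq_sum_multidegree]
    constructor
    · rintro ⟨G, hG, rfl⟩
      exact ⟨G.2, hG⟩
    · rintro ⟨h1, h2⟩
      exact ⟨⟨F, h1⟩, h2, rfl⟩
  rw [← this]
  exact ⟨Submodule.equivMapOfInjective _ Subtype.val_injective _⟩

end GradedPieces

/-! ### Counting monomials for joint invariants -/

section Counting

theorem encard_setOf_sum_eq (α : Type*) [Fintype α] (p : ℕ) :
    {f : α → ℕ | ∑ i, f i = p}.encard = ((Fintype.card α).multichoose p : ℕ) := by
  classical
  have : {f : α → ℕ | ∑ i, f i = p} =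
      Finsupp.equivFunOnFinite '' ((Finset.univ : Finset α).finsuppAntidiag p : Set (α →₀ ℕ)) := by
    ext f
    simp only [Set.mem_ofPred_eq, Set.mem_image, Finset.mem_coe, Finset.mem_finsuppAntidiag]
    constructor
    · intro h
      exact ⟨Finsupp.equivFunOnFinite.symm f, ⟨by simpa using h, Finset.subset_univ _⟩, by simp⟩
    · rintro ⟨g, ⟨hg, -⟩, rfl⟩
      exact hg
  rw [this, Function.Injective.encard_image Finsupp.equivFunOnFinite.injective,
    Set.encard_coe_eq_coe_finsetCard, Finset.card_finsuppAntidiag_nat_eq_multichoose,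
    Finset.card_univ]

theorem encard_setOf_sum_eq_and (α : Type*) [Fintype α] (p q : ℕ) :
    {f : (α → ℕ) × (α → ℕ) | ∑ i, f.1 i = p ∧ ∑ i, f.2 i = q}.encard =
      ((Fintype.card α).multichoose p * (Fintype.card α).multichoose q : ℕ) := by
  have : {f : (α → ℕ) × (α → ℕ) | ∑ i, f.1 i = p ∧ ∑ i, f.2 i = q} =
      {f : α → ℕ | ∑ i, f i = p} ×ˢ {f : α → ℕ | ∑ i, f i = q} := rfl
  rw [this, Set.encard_prod, encard_setOf_sum_eq, encard_setOf_sum_eq]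
  push_cast
  rfl

/-- An exponent as a pair of families: the exponents of the first and of the second coefficients. -/
noncomputable def exponentEquiv (ι : Type*) [Fintype ι] :
    (ι × Fin 2 →₀ ℕ) ≃ (ι → ℕ) × (ι → ℕ) where
  toFun m := (fun i => m (i, 0), fun i => m (i, 1))
  invFun f := Finsupp.equivFunOnFinite.symm fun p => ![f.1 p.1, f.2 p.1] p.2
  left_inv m := by
    ext ⟨i, b⟩
    fin_cases b <;> simp
  right_inv f := by
    ext i <;> simp

/-- The exponents of polynomials in `n` forms and one more. -/
noncomputable def exponentOptionEquiv (α : Type*) [Fintype α] :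
    (Option α × Fin 2 →₀ ℕ) ≃ ((α → ℕ) × (α → ℕ)) × (ℕ × ℕ) where
  toFun m := ((fun i => m (some i, 0), fun i => m (some i, 1)), (m (none, 0), m (none, 1)))
  invFun f := Finsupp.equivFunOnFinite.symm fun p =>
    p.1.elim (![f.2.1, f.2.2] p.2) fun i => ![f.1.1 i, f.1.2 i] p.2
  left_inv m := by
    ext ⟨i, b⟩
    cases i <;> fin_cases b <;> simp
  right_inv f := by
    ext i <;> simp

theorem encard_preimage_equiv {α β : Type*} (e : α ≃ β) (s : Set β) :
    (e ⁻¹' s).encard = s.encard := by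
  rw [← Equiv.image_symm_eq_preimage, Function.Injective.encard_image e.symm.injective]

variable (ι : Type*) [Fintype ι]

theorem ncard_balanced (p q : ℕ) (j : ℕ) (k : ℤ) (hj : j = p + q) (hk : k = p - q) :
    {m : ι × Fin 2 →₀ ℕ | multidegree m ∈ {μ : ι → ℕ | ∑ i, μ i * 1 = j} ∧
      torusWeight m = k}.ncard =
      (Fintype.card ι).multichoose p * (Fintype.card ι).multichoose q := by
  have : {m : ι × Fin 2 →₀ ℕ | multidegree m ∈ {μ : ι → ℕ | ∑ i, μ i * 1 = j} ∧
      torusWeight m = k} = exponentEquiv ι ⁻¹'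
        {f : (ι → ℕ) × (ι → ℕ) | ∑ i, f.1 i = p ∧ ∑ i, f.2 i = q} := by
    ext m
    simp only [Set.mem_ofPred_eq, Set.mem_preimage, exponentEquiv, Equiv.coe_fn_mk, multidegree,
      torusWeight, mul_one, Finset.sum_add_distrib, Finset.sum_sub_distrib, ← Nat.cast_sum]
    omega
  rw [this, Set.ncard, encard_preimage_equiv, encard_setOf_sum_eq_and, ENat.toNat_natCast]

theorem ncard_unbalanced (j : ℕ) (k : ℤ)
    (h : ∀ p q : ℕ, j = p + q → k ≠ p - q) :
    {m : ι × Fin 2 →₀ ℕ | multidegree m ∈ {μ : ι → ℕ | ∑ i, μ i * 1 = j} ∧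
      torusWeight m = k}.ncard = 0 := by
  have : {m : ι × Fin 2 →₀ ℕ | multidegree m ∈ {μ : ι → ℕ | ∑ i, μ i * 1 = j} ∧
      torusWeight m = k} = ∅ := by
    ext m
    simp only [Set.mem_ofPred_eq, multidegree, torusWeight, mul_one, Finset.sum_add_distrib,
      Finset.sum_sub_distrib, ← Nat.cast_sum, Set.mem_empty_iff_false, iff_false]
    rintro ⟨h1, h2⟩
    exact h _ _ h1.symm h2.symm
  rw [this, Set.ncard_empty]

theorem finite_setOf_sum_eq (j : ℕ) : {μ : ι → ℕ | ∑ i, μ i * 1 = j}.Finite := by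
  have := encard_setOf_sum_eq ι j
  simp only [mul_one]
  exact Set.finite_of_encard_eq_coe this

theorem finrank_invariantSpace_two_mul (k : ℕ) :
    Module.finrank ℂ (invariantSpace {μ : ι → ℕ | ∑ i, μ i * 1 = 2 * k}) +
      (if k = 0 then 0 else
        (Fintype.card ι).multichoose (k + 1) * (Fintype.card ι).multichoose (k - 1)) =
      (Fintype.card ι).multichoose k * (Fintype.card ι).multichoose k := by
  have h := finrank_invariantSpace (finite_setOf_sum_eq ι (2 * k))
  rw [ncard_balanced ι k k (2 * k) 0 (by omega) (by omega)] at h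
  rw [← h]
  congr 1
  -- In degree 0 no monomial has weight 2, whereas the truncated k - 1 would give a spurious term.
  split_ifs with hk
  · rw [ncard_unbalanced]
    intro p q
    omega
  · rw [ncard_balanced ι (k + 1) (k - 1) (2 * k) 2 (by omega) (by omega)]

theorem finrank_invariantSpace_two_mul_add_one (k : ℕ) :
    Module.finrank ℂ (invariantSpace {μ : ι → ℕ | ∑ i, μ i * 1 = 2 * k + 1}) = 0 := by
  have h := finrank_invariantSpace (finite_setOf_sum_eq ι (2 * k + 1))
  rw [ncard_unbalanced ι (2 * k + 1) 0 (by intro p q; omega)] at h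
  omega

end Counting

/-! ### Counting monomials for joint covariants -/

section CountingCovariants

variable (α : Type*) [Fintype α]

/-- Multidegrees of degree `j` in the first forms and of degree at most `D` in the last one. -/
def boundedOrder (j D : ℕ) : Set (Option α → ℕ) :=
  {μ | ∑ i, μ i * i.elim 0 1 = j ∧ μ none ≤ D}

theorem mem_boundedOrder {j D : ℕ} {μ : Option α → ℕ} :
    μ ∈ boundedOrder α j D ↔ ∑ i, μ (some i) = j ∧ μ none ≤ D := by
  simp [boundedOrder, Fintype.sum_option]

theorem finite_boundedOrder (j D : ℕ) : (boundedOrder α j D).Finite := by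
  classical
  refine (Set.finite_Iic (fun i : Option α => i.elim D fun _ => j)).subset ?_
  intro μ hμ i
  rw [mem_boundedOrder] at hμ
  cases i with
  | none => exact hμ.2
  | some i =>
    exact (Finset.single_le_sum (f := fun i => μ (some i)) (fun _ _ => Nat.zero_le _)
      (Finset.mem_univ i)).trans hμ.1.le

/-- Let (c, e) be the exponents of the last form. The shift (c, e) ↦ (c - 1, e + 1) matches weight 2
with c ≠ 0 to weight 0 with e ≠ 0. The remaining monomials are determined by their exponents in the
first forms. Swapping first and second coefficients matches these too, except for the weight 0
monomials whose two partial degrees differ by at most 1. The bound `hD` leaves room for the forced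
exponent of the last form. -/
theorem encard_boundedOrder {j D : ℕ} (hD : j ≤ D) :
    {m : Option α × Fin 2 →₀ ℕ | multidegree m ∈ boundedOrder α j D ∧
      torusWeight m = 0}.encard =
    {m : Option α × Fin 2 →₀ ℕ | multidegree m ∈ boundedOrder α j D ∧
      torusWeight m = 2}.encard +
      ((Fintype.card α).multichoose (j / 2) * (Fintype.card α).multichoose (j - j / 2) : ℕ) := by
  let A : ℤ → Set (((α → ℕ) × (α → ℕ)) × (ℕ × ℕ)) := fun k =>
    {x | ∑ i, x.1.1 i + ∑ i, x.1.2 i = j ∧ x.2.1 + x.2.2 ≤ D ∧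
      ((∑ i, x.1.1 i : ℕ) : ℤ) - (∑ i, x.1.2 i : ℕ) + x.2.1 - x.2.2 = k}
  have hA : ∀ k, {m : Option α × Fin 2 →₀ ℕ | multidegree m ∈ boundedOrder α j D ∧
      torusWeight m = k} = exponentOptionEquiv α ⁻¹' A k := by
    intro k
    ext m
    simp only [Set.mem_ofPred_eq, mem_boundedOrder, Set.mem_preimage, exponentOptionEquiv,
      Equiv.coe_fn_mk, multidegree, torusWeight, Finset.sum_add_distrib, Finset.sum_sub_distrib,
      ← Nat.cast_sum, Fintype.sum_option, A]
    push_cast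
    omega
  rw [hA, hA, encard_preimage_equiv, encard_preimage_equiv]
  let M : Set ((α → ℕ) × (α → ℕ)) :=
    {f | ∑ i, f.1 i + ∑ i, f.2 i = j ∧ ∑ i, f.1 i + 2 ≤ ∑ i, f.2 i}
  let T : Set ((α → ℕ) × (α → ℕ)) := {f | ∑ i, f.1 i = j / 2 ∧ ∑ i, f.2 i = j - j / 2}
  let Y : Set (((α → ℕ) × (α → ℕ)) × (ℕ × ℕ)) := A 2 ∩ {x | x.2.1 ≠ 0}
  -- `M` parametrizes the points with c = 0, with the two families swapped; there weight 2 forces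
  -- the value of e.
  have hA2 : A 2 = Y ∪ (fun f : (α → ℕ) × (α → ℕ) =>
      ((f.2, f.1), ((0 : ℕ), ∑ i, f.2 i - ∑ i, f.1 i - 2))) '' M := by
    ext ⟨⟨f, g⟩, c, e⟩
    simp only [A, M, Y, Set.mem_union, Set.mem_inter_iff, Set.mem_ofPred_eq, Set.mem_image,
      Prod.exists, Prod.mk.injEq]
    constructor
    · rintro ⟨h1, h2, h3⟩
      by_cases hc : c = 0
      · right
        subst hc
        exact ⟨g, f, ⟨by omega, by omega⟩, ⟨rfl, rfl⟩, rfl, by omega⟩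
      · exact Or.inl ⟨⟨h1, h2, h3⟩, hc⟩
    · rintro (⟨h, -⟩ | ⟨g, f, ⟨h1, h2⟩, ⟨rfl, rfl⟩, rfl, rfl⟩)
      · exact h
      · refine ⟨?_, ?_, ?_⟩ <;> omega
  -- `M ∪ T` parametrizes the points with e = 0; `T` is the unmatched rest.
  have hA0 : A 0 = (fun x : ((α → ℕ) × (α → ℕ)) × (ℕ × ℕ) => (x.1, (x.2.1 - 1, x.2.2 + 1))) '' Y ∪
      (fun f : (α → ℕ) × (α → ℕ) => (f, (∑ i, f.2 i - ∑ i, f.1 i, (0 : ℕ)))) '' (M ∪ T) := by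
    ext ⟨⟨f, g⟩, c, e⟩
    simp only [A, M, T, Y, Set.mem_union, Set.mem_inter_iff, Set.mem_ofPred_eq, Set.mem_image,
      Prod.exists, Prod.mk.injEq]
    constructor
    · rintro ⟨h1, h2, h3⟩
      by_cases he : e = 0
      · right
        subst he
        refine ⟨f, g, ?_, ⟨rfl, rfl⟩, by omega, rfl⟩
        by_cases h : ∑ i, f i + 2 ≤ ∑ i, g i
        · exact Or.inl ⟨h1, h⟩
        · right; constructor <;> omega
      · left
        exact ⟨f, g, c + 1, e - 1, ⟨⟨h1, by omega, by omega⟩, by omega⟩, ⟨rfl, rfl⟩,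
          by omega, by omega⟩
    · rintro (⟨f, g, c, e, ⟨⟨h1, h2, h3⟩, hc⟩, ⟨rfl, rfl⟩, rfl, rfl⟩ |
        ⟨f, g, h, ⟨rfl, rfl⟩, rfl, rfl⟩)
      · refine ⟨h1, by omega, by omega⟩
      · rcases h with ⟨h1, h2⟩ | ⟨h1, h2⟩ <;> refine ⟨?_, ?_, ?_⟩ <;> omega
  rw [hA2, hA0, Set.encard_union_eq, Set.encard_union_eq, Set.InjOn.encard_image,
    Function.Injective.encard_image, Function.Injective.encard_image, Set.encard_union_eq,
    encard_setOf_sum_eq_and, add_assoc]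
  · rw [Set.disjoint_left]
    rintro f ⟨h1, h2⟩ ⟨h3, h4⟩
    omega
  · rintro ⟨f, g⟩ ⟨f', g'⟩ h
    simp only [Prod.mk.injEq] at h ⊢
    exact ⟨h.1.2, h.1.1⟩
  · rintro ⟨f, g⟩ ⟨f', g'⟩ h
    simp only [Prod.mk.injEq] at h ⊢
    exact h.1
  · rintro ⟨⟨f, g⟩, c, e⟩ ⟨-, h⟩ ⟨⟨f', g'⟩, c', e'⟩ ⟨-, h'⟩ heq
    simp only [Prod.mk.injEq, Set.mem_ofPred_eq] at h h' heq ⊢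
    exact ⟨heq.1, by omega, by omega⟩
  · rw [Set.disjoint_left]
    rintro x ⟨-, h⟩ ⟨f, -, rfl⟩
    exact h rfl
  · rw [Set.disjoint_left]
    rintro x ⟨y, -, rfl⟩ ⟨f, -, h⟩
    simp only [Prod.mk.injEq] at h
    omega

theorem finrank_invariantSpace_boundedOrder {j D : ℕ} (hD : j ≤ D) :
    Module.finrank ℂ (invariantSpace (boundedOrder α j D)) =
      (Fintype.card α).multichoose (j / 2) * (Fintype.card α).multichoose (j - j / 2) := by
  have h := finrank_invariantSpace (finite_boundedOrder α j D)
  have hfin : {m : Option α × Fin 2 →₀ ℕ | multidegree m ∈ boundedOrder α j D ∧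
      torusWeight m = 2}.Finite :=
    (finite_setOf_multidegree (finite_boundedOrder α j D)).subset fun m hm => hm.1
  have h2 := congrArg ENat.toNat (encard_boundedOrder α hD)
  rw [ENat.toNat_add hfin.encard_lt_top.ne (ENat.natCast_ne_top _), ENat.toNat_natCast] at h2
  change Set.ncard _ = Set.ncard _ + _ at h2
  omega

/-- The dimension with order at most D is the same for all D ≥ j, so a covariant of degree j has
order at most j. This makes the graded piece finite-dimensional although the order is not bounded in
its definition. -/
theorem invariantSpace_covariant_eq (j : ℕ) :
    invariantSpace {μ : Option α → ℕ | ∑ i, μ i * i.elim 0 1 = j} =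
      invariantSpace (boundedOrder α j j) := by
  apply le_antisymm
  · rintro F ⟨hF, hF'⟩
    set D := max j (F.support.sup fun m => multidegree m none) with hDdef
    have hle : invariantSpace (boundedOrder α j j) ≤ invariantSpace (boundedOrder α j D) :=
      inf_le_inf_left _ (restrictSupport_mono _
        fun m hm => ⟨hm.1, hm.2.trans (le_max_left _ _)⟩)
    have := finite_invariantSpace (finite_boundedOrder α j D)
    rw [Submodule.eq_of_le_of_finrank_eq hle (by
      rw [finrank_invariantSpace_boundedOrder α le_rfl,
        finrank_invariantSpace_boundedOrder α (le_max_left _ _)])]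
    refine ⟨hF, fun m hm => ⟨hF' hm, ?_⟩⟩
    exact le_max_of_le_right
      (Finset.le_sup (f := fun m : Option α × Fin 2 →₀ ℕ => multidegree m none) hm)
  · exact inf_le_inf_left _ (restrictSupport_mono _ fun m hm => hm.1)

end CountingCovariants

/-! ### Binomial identities and finite differences -/

section Numerics

open Nat in
theorem exists_polynomial_choose (m s : ℕ) : ∃ P : Polynomial ℂ, P.Monic ∧ P.natDegree = m ∧
    ∀ k : ℕ, P.eval (k : ℂ) = (m ! : ℂ) * ((k + s + m).choose m : ℂ) := by
  refine ⟨(ascPochhammer ℂ m).comp (Polynomial.X + Polynomial.C ((s : ℂ) + 1)),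
    (monic_ascPochhammer ℂ m).comp_X_add_C _, ?_, fun k => ?_⟩
  · rw [Polynomial.natDegree_comp, Polynomial.natDegree_X_add_C, mul_one,
      ascPochhammer_natDegree]
  · have h := ascPochhammer_nat_eq_ascFactorial (k + s + 1) m
    rw [Nat.ascFactorial_eq_factorial_mul_choose] at h
    rw [Polynomial.eval_comp, Polynomial.eval_add, Polynomial.eval_X, Polynomial.eval_C,
      show (k : ℂ) + (s + 1) = ((k + s + 1 : ℕ) : ℂ) by push_cast; ring,
      ← ascPochhammer_map (algebraMap ℕ ℂ), ← map_natCast (algebraMap ℕ ℂ) (k + s + 1),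
      Polynomial.eval_map_apply, Nat.cast_id, h, map_mul]
    rfl

theorem fwdDiff_iter_natCast (P : Polynomial ℂ) (D k : ℕ) :
    (fwdDiff 1)^[D] (fun k : ℕ => P.eval (k : ℂ)) k = (fwdDiff 1)^[D] P.eval (k : ℂ) := by
  rw [fwdDiff_iter_eq_sum_shift, fwdDiff_iter_eq_sum_shift]
  simp

/-- The forward difference of order `2 m` of a product of two binomial coefficients. -/
theorem fwdDiff_iter_choose_mul_choose (m s t : ℕ) :
    (fwdDiff 1)^[2 * m] (fun k : ℕ =>
      ((k + s + m).choose m : ℂ) * ((k + t + m).choose m : ℂ)) =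
      fun _ => ((2 * m).choose m : ℂ) := by
  obtain ⟨P, hP, hPd, hPe⟩ := exists_polynomial_choose m s
  obtain ⟨Q, hQ, hQd, hQe⟩ := exists_polynomial_choose m t
  have hm : (m.factorial : ℂ) ≠ 0 := by exact_mod_cast m.factorial_ne_zero
  have hfun : (fun k : ℕ => ((k + s + m).choose m : ℂ) * ((k + t + m).choose m : ℂ)) =
      ((m.factorial : ℂ) * m.factorial)⁻¹ • fun k : ℕ => (P * Q).eval (k : ℂ) := by
    -- Each binomial coefficient is a polynomial in k with leading coefficient 1/m!, so the
    -- difference of order 2m is (2m)!/(m!)².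
    ext k
    rw [Pi.smul_apply, Polynomial.eval_mul, hPe, hQe, smul_eq_mul]
    field_simp
  have hdeg : (P * Q).natDegree = 2 * m := by
    rw [hP.natDegree_mul hQ, hPd, hQd, two_mul]
  rw [hfun, fwdDiff_iter_const_smul]
  ext k
  rw [Pi.smul_apply, fwdDiff_iter_natCast, ← hdeg, Polynomial.fwdDiff_iter_degree_eq_factorial,
    (hP.mul hQ).leadingCoeff, hdeg, Nat.choose_eq_factorial_div_factorial (by omega),
    Nat.cast_div_charZero (Nat.factorial_mul_factorial_dvd_factorial (by omega))]
  have : 2 * m - m = m := by omega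
  rw [this]
  simp
  field_simp

theorem multichoose_succ (m p : ℕ) : (m + 1).multichoose p = (p + m).choose m := by
  rw [Nat.multichoose_eq, show m + 1 + p - 1 = p + m by omega, ← Nat.choose_symm_add]

/-- The difference of products of binomial coefficients counting joint invariants. -/
theorem mul_finrank_eq (m k d : ℕ)
    (h : d + (if k = 0 then 0 else (m + 2).multichoose (k + 1) * (m + 2).multichoose (k - 1)) =
      (m + 2).multichoose k * (m + 2).multichoose k) :
    (m + 1) * d = (k + m).choose m * (k + 1 + m).choose m := by
  simp only [multichoose_succ (m + 1)] at h
  rcases k with _ | l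
  · simp only [if_true, add_zero, zero_add, Nat.choose_self, mul_one] at h
    rw [h, zero_add, Nat.choose_self, one_mul, add_comm 1 m, Nat.choose_succ_self_right, mul_one]
  · rw [if_neg (Nat.succ_ne_zero l), Nat.add_sub_cancel] at h
    -- Absorption (`h1`, `h2`) and Pascal's rule (`h3`, `h4`) express everything through five
    -- binomial coefficients; after multiplication by m + 1 the claim is linear algebra in these
    -- relations.
    have h1 := Nat.choose_succ_right_eq (l + (m + 1)) m
    have h2 := Nat.choose_succ_right_eq (l + 1 + (m + 1)) m
    have h3 := Nat.choose_succ_succ (l + (m + 1)) m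
    have h4 := Nat.choose_succ_succ (l + 1 + (m + 1)) m
    rw [show l + (m + 1) - m = l + 1 by omega] at h1
    rw [show l + 1 + (m + 1) - m = l + 2 by omega] at h2
    rw [show (l + (m + 1)).succ = l + 1 + (m + 1) by omega] at h3
    rw [show (l + 1 + (m + 1)).succ = l + 1 + 1 + (m + 1) by omega] at h4
    simp only [Nat.succ_eq_add_one] at h3 h4
    rw [show l + 1 + m = l + (m + 1) by omega, show l + 1 + 1 + m = l + 1 + (m + 1) by omega]
    generalize (l + 1 + 1 + (m + 1)).choose (m + 1) = z at *
    generalize (l + 1 + (m + 1)).choose (m + 1) = y at *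
    generalize (l + (m + 1)).choose (m + 1) = x at *
    generalize (l + (m + 1)).choose m = a at *
    generalize (l + 1 + (m + 1)).choose m = b at *
    have hm : (m : ℤ) + 1 ≠ 0 := by positivity
    zify at *
    have hd : (d : ℤ) = y * y - z * x := by linear_combination h
    have hya : (m + 1 : ℤ) * y = a * (l + m + 2) := by linear_combination (m + 1) * h3 + h1
    have hzb : (m + 1 : ℤ) * z = b * (l + m + 3) := by linear_combination (m + 1) * h4 + h2
    apply mul_left_cancel₀ hm
    rw [hd]
    linear_combination (m + 1) * y * hya + a * (l + m + 2) * h2 -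
      (m + 1) * x * hzb - b * (l + m + 3) * h1

theorem choose_le_mul_pow (m s k j : ℕ) (h : k ≤ j) :
    (k + s + m).choose m ≤ ((m + s + 1) * (j + 1)) ^ m := by
  refine (Nat.choose_le_pow _ _).trans (Nat.pow_le_pow_left ?_ m)
  nlinarith [Nat.zero_le (m * j), Nat.zero_le (s * j)]

/-- Absorption turns (m + 1)/k · C(m, k-1) into C(m+1, k), and Vandermonde's identity sums C(m+1, k)
C(m-1, m-k) to C(2m, m). -/
theorem narayana_eval_one {m : ℕ} (hm : 1 ≤ m) :
    (narayana m).eval 1 = ((2 * m).choose m : ℂ) / ((m : ℂ) + 1) := by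
  have hm0 : ((m : ℂ) + 1) ≠ 0 := by exact_mod_cast Nat.succ_ne_zero m
  rw [eq_div_iff hm0]
  have hterm : ∀ k ∈ Finset.Icc 1 m, (1 / (k : ℂ)) * ((m - 1).choose (k - 1) : ℂ) *
      (m.choose (k - 1) : ℂ) * (m + 1) = (((m + 1).choose k * (m - 1).choose (m - k) : ℕ) : ℂ) := by
    intro k hk
    rw [Finset.mem_Icc] at hk
    obtain ⟨l, rfl⟩ := Nat.exists_eq_add_of_le' hk.1
    have h1 : (m - 1).choose (m - (l + 1)) = (m - 1).choose l := by
      rw [← Nat.choose_symm (show l ≤ m - 1 by omega)]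
      congr 1
      omega
    have h2 := Nat.add_one_mul_choose_eq m l
    have hl : ((l : ℂ) + 1) ≠ 0 := by exact_mod_cast Nat.succ_ne_zero l
    rw [h1, Nat.add_sub_cancel]
    have h3 : ((m : ℂ) + 1) * (m.choose l : ℂ) = ((m + 1).choose (l + 1) : ℂ) * (l + 1) := by
      exact_mod_cast h2
    push_cast
    field_simp
    linear_combination ((m - 1).choose l : ℂ) * h3
  rw [narayana, Polynomial.eval_finsetSum, Finset.sum_mul]
  simp only [Polynomial.eval_mul, Polynomial.eval_C, Polynomial.eval_pow, Polynomial.eval_X,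
    one_pow, mul_one]
  rw [Finset.sum_congr rfl hterm, ← Nat.cast_sum]
  congr 1
  have hv := Nat.add_choose_eq (m + 1) (m - 1) m
  rw [Finset.Nat.sum_antidiagonal_eq_sum_range_succ_mk, Finset.sum_range_succ'] at hv
  rw [show 2 * m = m + 1 + (m - 1) by omega, hv]
  simp only [Nat.choose_zero_right, Nat.sub_zero, one_mul]
  -- The Vandermonde term k = 0, absent from the Narayana sum, vanishes.
  rw [Nat.choose_eq_zero_of_lt (show m - 1 < m by omega), add_zero]
  refine Finset.sum_bij' (fun k _ => k - 1) (fun k _ => k + 1) (fun k hk => ?_) (fun k hk => ?_)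
    (fun k hk => ?_) (fun k hk => ?_) fun k hk => ?_
  · rw [Finset.mem_Icc] at hk
    exact Finset.mem_range.2 (by omega)
  · rw [Finset.mem_range] at hk
    exact Finset.mem_Icc.2 (by omega)
  · exact Nat.sub_add_cancel (Finset.mem_Icc.1 hk).1
  · exact Nat.add_sub_cancel k 1
  · rw [Nat.sub_add_cancel (Finset.mem_Icc.1 hk).1]

end Numerics

/-! ### Degrees of the two algebras -/

section Transfer

theorem isWeightedHomogeneous_aeval {σ τ : Type*} {w : σ → ℕ} {w' : τ → ℕ}
    {f : σ → MvPolynomial τ ℂ} (hf : ∀ i, IsWeightedHomogeneous w' (f i) (w i)) {j : ℕ}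
    {F : MvPolynomial σ ℂ} (hF : IsWeightedHomogeneous w F j) :
    IsWeightedHomogeneous w' (aeval f F) j := by
  rw [F.as_sum, map_sum]
  refine IsWeightedHomogeneous.sum _ _ _ fun m hm => ?_
  have hm' := hF (mem_support_iff.1 hm)
  rw [aeval_monomial, ← hm', Finsupp.weight_apply]
  exact (IsWeightedHomogeneous.prod _ _ (fun i => m i • w i) fun i _ => (hf i).pow _).C_mul _

/-- The weights of the forms in the algebra of covariants: the last form, which stands for the
vector, has weight `0`. -/
def covariantWeight (n : ℕ) (i : Option (Fin n)) : ℕ := i.elim 0 fun _ => 1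

theorem covariantEquiv_mem_iff (n j : ℕ) (F : MvPolynomial ((Fin n × Fin 2) ⊕ Fin 2) ℂ) :
    F ∈ weightedHomogeneousSubmodule ℂ
      (Sum.elim (fun _ : Fin n × Fin 2 => 1) (fun _ : Fin 2 => 0) : _ → ℕ) j ↔
    covariantEquiv n F ∈ weightedHomogeneousSubmodule ℂ
      (fun p : Option (Fin n) × Fin 2 => covariantWeight n p.1) j := by
  constructor
  · intro h
    refine isWeightedHomogeneous_aeval (fun p => ?_) h
    obtain ⟨i, b⟩ | b := p
    · exact isWeightedHomogeneous_X ℂ (fun p : Option (Fin n) × Fin 2 => covariantWeight n p.1) _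
    · fin_cases b
      · exact isWeightedHomogeneous_X ℂ (fun p : Option (Fin n) × Fin 2 => covariantWeight n p.1)
          (none, 1)
      · exact (isWeightedHomogeneous_X ℂ
          (fun p : Option (Fin n) × Fin 2 => covariantWeight n p.1) (none, 0)).neg
  · intro h
    rw [← (covariantEquiv n).symm_apply_apply F]
    refine isWeightedHomogeneous_aeval (fun p => ?_) h
    obtain ⟨_ | i, b⟩ := p
    · fin_cases b
      · exact (isWeightedHomogeneous_X ℂ
          (Sum.elim (fun _ : Fin n × Fin 2 => 1) (fun _ : Fin 2 => 0)) (Sum.inr 1)).neg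
      · exact isWeightedHomogeneous_X ℂ
          (Sum.elim (fun _ : Fin n × Fin 2 => 1) (fun _ : Fin 2 => 0)) (Sum.inr 0)
    · exact isWeightedHomogeneous_X ℂ
        (Sum.elim (fun _ : Fin n × Fin 2 => 1) (fun _ : Fin 2 => 0)) _

/-- Common to invariants and covariants. By `hD` the growth bound D + 1 coincides with the number 2
· card - 3 of independent brackets, which fixes the transcendence degree. -/
theorem hasDegree_of_algEquiv {R ι : Type} [CommRing R] [IsDomain R] [Algebra ℂ R] [Fintype ι]
    {𝒜 : ℕ → Submodule ℂ R} (w : ι → ℕ) (e : R ≃ₐ[ℂ] polarInvariants ι)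
    (he : ∀ j x, x ∈ 𝒜 j ↔ e x ∈ weightedPiece w j)
    (hfin : ∀ j, Module.Finite ℂ (invariantSpace {μ : ι → ℕ | ∑ i, μ i * w i = j}))
    (D : ℕ) (hD : 2 * Fintype.card ι = D + 4) (C : ℕ)
    (hC : ∀ j, Module.finrank ℂ (invariantSpace {μ : ι → ℕ | ∑ i, μ i * w i = j}) ≤
      C * (j + 1) ^ D)
    (f₀ f₁ : ℕ → ℂ)
    (h₀ : ∀ k, (Module.finrank ℂ
      (invariantSpace {μ : ι → ℕ | ∑ i, μ i * w i = 2 * k}) : ℂ) = f₀ k)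
    (h₁ : ∀ k, (Module.finrank ℂ
      (invariantSpace {μ : ι → ℕ | ∑ i, μ i * w i = 2 * k + 1}) : ℂ) = f₁ k) (c₀ c₁ : ℂ)
    (hc₀ : (fwdDiff 1)^[D] f₀ = fun _ => c₀) (hc₁ : (fwdDiff 1)^[D] f₁ = fun _ => c₁) :
    HasDegree 𝒜 ((c₀ + c₁) / 2 ^ (D + 1)) := by
  have e₁ : ∀ j, weightedPiece w j ≃ₗ[ℂ] invariantSpace {μ : ι → ℕ | ∑ i, μ i * w i = j} :=
    fun j => (weightedPiece_equiv w j).some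
  have e₂ : ∀ j, 𝒜 j ≃ₗ[ℂ] weightedPiece w j :=
    fun j => (nonempty_linearEquiv_of_algEquiv e (𝒜 j) (weightedPiece w j) (he j)).some
  have hr : ∀ j, Module.finrank ℂ (𝒜 j) =
      Module.finrank ℂ (invariantSpace {μ : ι → ℕ | ∑ i, μ i * w i = j}) :=
    fun j => ((e₂ j).trans (e₁ j)).finrank_eq
  have hfin' : ∀ j, Module.Finite ℂ (weightedPiece w j) := fun j =>
    have := hfin j
    Module.Finite.equiv (e₁ j).symm
  refine hasDegree_of_finrank (fun j => ?_) D ?_ f₀ f₁ (fun k => by rw [hr, h₀])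
    (fun k => by rw [hr, h₁]) c₀ c₁ hc₀ hc₁
  · have := hfin' j
    exact Module.Finite.equiv (e₂ j).symm
  · rw [e.trdeg_eq]
    refine le_antisymm (trdeg_polarInvariants_le w hfin' C D fun j => ?_) ?_
    · rw [(e₁ j).finrank_eq]
      exact hC j
    · have := le_trdeg_polarInvariants (ι := ι) (by omega)
      rwa [show 2 * Fintype.card ι - 3 = D + 1 by omega] at this

theorem hasDegree_invariantsPiece (m : ℕ) : HasDegree (invariantsPiece (m + 2))
    (((2 * m).choose m : ℂ) / ((m : ℂ) + 1) / 2 ^ (2 * m + 1)) := by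
  have hm0 : ((m : ℂ) + 1) ≠ 0 := by exact_mod_cast Nat.succ_ne_zero m
  have hd : ∀ k, (m + 1) * Module.finrank ℂ
      (invariantSpace {μ : Fin (m + 2) → ℕ | ∑ i, μ i * 1 = 2 * k}) =
      (k + m).choose m * (k + 1 + m).choose m := fun k =>
    mul_finrank_eq m k _ (by
      simpa only [Fintype.card_fin] using finrank_invariantSpace_two_mul (Fin (m + 2)) k)
  have key := hasDegree_of_algEquiv (𝒜 := invariantsPiece (m + 2)) (fun _ : Fin (m + 2) => 1)
    (Subalgebra.equivOfEq _ _ (jointInvariants_eq (m + 2))) (fun j x => Iff.rfl)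
    (fun j => finite_invariantSpace (finite_setOf_sum_eq _ j)) (2 * m)
    (by rw [Fintype.card_fin]; ring) ((m + 2) ^ (2 * m)) (fun j => ?_)
    (fun k => ((m : ℂ) + 1)⁻¹ * (((k + m).choose m : ℂ) * ((k + 1 + m).choose m : ℂ)))
    (fun _ => 0) (fun k => ?_) (fun k => ?_) (((2 * m).choose m : ℂ) / ((m : ℂ) + 1)) 0 ?_ ?_
  · simpa using key
  · rcases Nat.even_or_odd' j with ⟨k, rfl | rfl⟩
    · refine (Nat.le_mul_of_pos_left _ (Nat.succ_pos m)).trans ((hd k).trans_le ?_)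
      have h1 := choose_le_mul_pow m 0 k (2 * k) (by omega)
      have h2 := choose_le_mul_pow m 1 k (2 * k) (by omega)
      refine (Nat.mul_le_mul h1 h2).trans ?_
      rw [two_mul m, ← mul_pow (m + 2)]
      calc ((m + 0 + 1) * (2 * k + 1)) ^ m * ((m + 1 + 1) * (2 * k + 1)) ^ m
          ≤ ((m + 2) * (2 * k + 1)) ^ m * ((m + 2) * (2 * k + 1)) ^ m := by gcongr <;> omega
        _ = _ := (pow_add _ _ _).symm
    · rw [finrank_invariantSpace_two_mul_add_one]
      exact Nat.zero_le _
  · have := hd k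
    rw [eq_inv_mul_iff_mul_eq₀ hm0]
    exact_mod_cast this
  · rw [finrank_invariantSpace_two_mul_add_one, Nat.cast_zero]
  · have h := fwdDiff_iter_choose_mul_choose m 0 1
    have hs : (fun k : ℕ => ((m : ℂ) + 1)⁻¹ *
        (((k + m).choose m : ℂ) * ((k + 1 + m).choose m : ℂ))) =
        ((m : ℂ) + 1)⁻¹ • fun k : ℕ =>
          ((k + 0 + m).choose m : ℂ) * ((k + 1 + m).choose m : ℂ) := rfl
    rw [hs, fwdDiff_iter_const_smul, h]
    ext k
    simp [div_eq_inv_mul]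
  · ext k
    simp [fwdDiff_iter_eq_sum_shift]

theorem hasDegree_covariantsPiece (m : ℕ) : HasDegree (covariantsPiece (m + 1))
    (((2 * m).choose m : ℂ) / 2 ^ (2 * m)) := by
  have hset : ∀ j, {μ : Option (Fin (m + 1)) → ℕ | ∑ i, μ i * covariantWeight (m + 1) i = j} =
      {μ | ∑ i, μ i * i.elim 0 1 = j} := fun j => rfl
  have hd : ∀ j, Module.finrank ℂ (invariantSpace
      {μ : Option (Fin (m + 1)) → ℕ | ∑ i, μ i * covariantWeight (m + 1) i = j}) =
      (j / 2 + m).choose m * (j - j / 2 + m).choose m := fun j => by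
    rw [hset, invariantSpace_covariant_eq, finrank_invariantSpace_boundedOrder _ le_rfl,
      Fintype.card_fin, multichoose_succ, multichoose_succ]
  have key := hasDegree_of_algEquiv (𝒜 := covariantsPiece (m + 1)) (covariantWeight (m + 1))
    (jointCovariantsEquiv (m + 1)) (fun j x => covariantEquiv_mem_iff (m + 1) j x.1)
    (fun j => by
      rw [hset, invariantSpace_covariant_eq]
      exact finite_invariantSpace (finite_boundedOrder _ j j))
    (2 * m) (by rw [Fintype.card_option, Fintype.card_fin]; ring) ((m + 1) ^ (2 * m))
    (fun j => ?_)
    (fun k => ((k + 0 + m).choose m : ℂ) * ((k + 0 + m).choose m : ℂ))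
    (fun k => ((k + 0 + m).choose m : ℂ) * ((k + 1 + m).choose m : ℂ))
    (fun k => ?_) (fun k => ?_) _ _ (fwdDiff_iter_choose_mul_choose m 0 0)
    (fwdDiff_iter_choose_mul_choose m 0 1)
  -- Both parities contribute C(2m, m), and the factor 2 cancels against 2^(2m+1).
  · convert key using 1
    rw [pow_succ]
    field_simp
    norm_num
  · rw [hd]
    have h1 := choose_le_mul_pow m 0 (j / 2) j (by omega)
    have h2 := choose_le_mul_pow m 0 (j - j / 2) j (by omega)
    refine (Nat.mul_le_mul h1 h2).trans (le_of_eq ?_)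
    rw [← pow_add, two_mul, mul_pow]
  · rw [hd, show 2 * k / 2 = k by omega, show 2 * k - k = k by omega]
    push_cast
    rfl
  · rw [hd, show (2 * k + 1) / 2 = k by omega, show 2 * k + 1 - k = k + 1 by omega]
    push_cast
    rfl

end Transfer

theorem theorem3 (n : ℕ) :
    (2 ≤ n → HasDegree (invariantsPiece n)
      (((2 * n - 4).choose (n - 2) : ℂ) / (((n : ℂ) - 1) * 2 ^ (2 * n - 3)))) ∧
    (3 ≤ n →
      HasDegree (invariantsPiece n) ((narayana (n - 2)).eval 1 / 2 ^ (2 * n - 3)) ∧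
      (narayana (n - 2)).eval 1 / 2 ^ (2 * n - 3) =
        ((2 * n - 4).choose (n - 2) : ℂ) / (((n : ℂ) - 1) * 2 ^ (2 * n - 3))) ∧
    (1 ≤ n → HasDegree (covariantsPiece n)
      (((2 * n - 2).choose (n - 1) : ℂ) / 2 ^ (2 * n - 2))) := by
  have hinv : 2 ≤ n → HasDegree (invariantsPiece n)
      (((2 * n - 4).choose (n - 2) : ℂ) / (((n : ℂ) - 1) * 2 ^ (2 * n - 3))) := by
    intro hn
    obtain ⟨m, rfl⟩ := Nat.exists_eq_add_of_le' hn
    convert hasDegree_invariantsPiece m using 1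
    rw [show 2 * (m + 2) - 4 = 2 * m by omega, show 2 * (m + 2) - 3 = 2 * m + 1 by omega,
      Nat.add_sub_cancel, div_div]
    push_cast
    ring
  have hnar : 3 ≤ n → (narayana (n - 2)).eval 1 / 2 ^ (2 * n - 3) =
      ((2 * n - 4).choose (n - 2) : ℂ) / (((n : ℂ) - 1) * 2 ^ (2 * n - 3)) := by
    intro hn
    rw [narayana_eval_one (by omega), show 2 * (n - 2) = 2 * n - 4 by omega, div_div,
      Nat.cast_sub (by omega)]
    congr 2
    push_cast
    ring
  refine ⟨hinv, fun hn => ⟨?_, hnar hn⟩, fun hn => ?_⟩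
  · rw [hnar hn]
    exact hinv (by omega)
  · obtain ⟨m, rfl⟩ := Nat.exists_eq_add_of_le' hn
    have := hasDegree_covariantsPiece m
    rwa [show 2 * (m + 1) - 2 = 2 * m by omega, Nat.add_sub_cancel]
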